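/- Let $\gamma>0$ be real. For a positive integer $N$ and $\lambda\in\mathbb R^N$ put $V(\lambda)=\prod_{1\le i<j\le N}(\lambda_j-\lambda_i)$, and for real $t>0$ let $$W_\gamma(N,t)=\frac{\int_{\mathbb R^N}|V(\lambda)|^{2\gamma}\prod_{j=1}^N e^{-i\gamma\lambda_j/\sqrt t}\,(1-i\sqrt t\,\lambda_j)^{-\gamma/t}\,d\lambda}{\int_{\mathbb R^N}|V(\lambda)|^{2\gamma}e^{-\frac{\gamma}{2}(\lambda_1^2+\cdots+\lambda_N^2)}\,d\lambda}$$ (with $i=\sqrt{-1}$ and principal powers). For each $N\geq 1$ the denominator converges to a positive number, and for all sufficiently small $t>0$ the numerator converges absolutely and $W_\gamma(N,t)\notin(-\infty,0]$. Moreover there is exactly one formal power series in $t$ with coefficients that are real polynomials in $x$, denoted $\log W_\gamma(x,t)\in\mathbb R[x][[t]]$, such that for every integer $N\ge1$ the substitution $x=N$ gives the asymptotic expansion, as $t\to0^+$, of the principal logarithm of $W_\gamma(N,t)$. For integers $g,s\ge1$ let $$\xi_g^s(\gamma)=s!\,(-1)^s\,[x^st^{g+s-1}]\,\frac1\gamma\log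 W_\gamma(x,t),$$ where $[x^st^k]$ denotes the coefficient of $x^st^k$, and let $B_j$ be the Bernoulli numbers, $\frac{t}{e^t-1}=\sum_{j\ge0}B_j\frac{t^j}{j!}$ (so $B_1=-\tfrac12$). Then, for all $g,s\geq 1$, $$\xi_g^s(\gamma)=\begin{cases}\dfrac{(g+s-2)!}{g!}(-1)^s\dfrac{B_g}{2}\left(\dfrac1{\gamma^g}-\dfrac1\gamma\right),&g\text{ even},\\[3mm]\dfrac{(g+s-2)!\,(-1)^{s+1}}{(g+1)!}\left\{\dfrac{(g+1)B_g}{\gamma^g}+\displaystyle\sum_{r=0}^{g+1}\binom{g+1}{r}B_{g+1-r}\dfrac{B_r}{\gamma^r}\right\},&g\text{ odd}.\end{cases}$$ -/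

import Mathlib

open scoped BigOperators Nat Polynomial PowerSeries Topology
open MeasureTheory Filter Asymptotics

noncomputable section

namespace ParamEuler

/-- The Vandermonde product `V(l) = ∏_{i < j} (l_j - l_i)`. -/
def V {N : ℕ} (l : Fin N → ℝ) : ℝ :=
  ∏ i : Fin N, ∏ j ∈ Finset.Ioi i, (l j - l i)

/-- The integrand of the numerator of `W_γ(N,t)`; complex powers are principal
(the base `1 - i √t l_j` has real part `1`). -/
def numIntegrand (γ : ℝ) (N : ℕ) (t : ℝ) (l : Fin N → ℝ) : ℂ :=
  ((|V l| ^ (2 * γ) : ℝ) : ℂ) *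
    ∏ j : Fin N,
      (Complex.exp (-Complex.I * γ * (l j) / (Real.sqrt t : ℝ)) *
        (1 - Complex.I * (Real.sqrt t : ℝ) * (l j)) ^ (((-γ / t : ℝ)) : ℂ))

/-- The integrand of the denominator of `W_γ(N,t)`. -/
def denIntegrand (γ : ℝ) (N : ℕ) (l : Fin N → ℝ) : ℝ :=
  |V l| ^ (2 * γ) * Real.exp (-γ * (∑ j : Fin N, (l j) ^ 2) / 2)

/-- `W_γ(N,t)`, a ratio of integrals over `ℝ^N` with respect to Lebesgue measure. -/
def W (γ : ℝ) (N : ℕ) (t : ℝ) : ℂ :=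
  (∫ l : Fin N → ℝ, numIntegrand γ N t l) / ((∫ l : Fin N → ℝ, denIntegrand γ N l : ℝ) : ℂ)

/-- `L ∈ ℝ[x]⟦t⟧` is the expansion of `log W_γ(x,t)`: its coefficients are polynomials in `x`, and
putting `x = N` gives the asymptotic expansion of `log W_γ(N,t)` as `t → 0⁺`,
for every positive integer `N`. -/
def IsLogWExpansion (γ : ℝ) (L : ℝ[X]⟦X⟧) : Prop :=
  ∀ N : ℕ, 1 ≤ N → ∀ n : ℕ,
    (fun t : ℝ => Complex.log (W γ N t) -
        ((∑ k ∈ Finset.range (n + 1), (PowerSeries.coeff k L).eval (N : ℝ) * t ^ k : ℝ) : ℂ))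
      =o[𝓝[>] (0 : ℝ)] (fun t : ℝ => t ^ n)

open Classical in
/-- The formal series `log W_γ(x,t) ∈ ℝ[x]⟦t⟧` (the value `0` is used if there is none). -/
def logW (γ : ℝ) : ℝ[X]⟦X⟧ :=
  if h : ∃ L : ℝ[X]⟦X⟧, IsLogWExpansion γ L then h.choose else 0

/-- The parametrized Euler characteristic
`ξ_g^s(γ) = s! (-1)^s [x^s t^(g+s-1)] γ⁻¹ log W_γ(x,t)`, for `g, s ≥ 1`. -/
def xi (g s : ℕ) (γ : ℝ) : ℝ :=
  (s ! : ℝ) * (-1) ^ s * (γ⁻¹ * (PowerSeries.coeff (g + s - 1) (logW γ)).coeff s)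

end ParamEuler

end

noncomputable section

namespace ParamEuler

/-- The Bernoulli polynomial `B_n` with real coefficients. -/
def bernoulliPoly (n : ℕ) : ℝ[X] :=
  (Polynomial.bernoulli n).map (algebraMap ℚ ℝ)

lemma coeff_bernoulliPoly (n i : ℕ) :
    (bernoulliPoly n).coeff i = if i ≤ n then (bernoulli (n - i) : ℝ) * (n.choose i : ℝ) else 0 := by
  rw [bernoulliPoly, Polynomial.coeff_map, Polynomial.coeff_bernoulli]
  split_ifs <;> simp

lemma eval_bernoulliPoly (n : ℕ) (h : ℝ) :
    (bernoulliPoly n).eval h =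
      ∑ i ∈ Finset.range (n + 1), (n.choose i : ℝ) * (bernoulli (n - i) : ℝ) * h ^ i := by
  rw [bernoulliPoly, Polynomial.bernoulli_def, Polynomial.map_sum, Polynomial.eval_finsetSum]
  refine Finset.sum_congr rfl fun i _ => ?_
  simp only [Polynomial.map_monomial, Polynomial.eval_monomial, map_mul, map_natCast, eq_ratCast]
  ring

lemma sum_choose_mul_eval_bernoulliPoly (n : ℕ) (h : ℝ) :
    ∑ k ∈ Finset.range (n + 1), ((n + 1).choose k : ℝ) * (bernoulliPoly k).eval h =
      (n + 1) * h ^ n := by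
  have := congrArg (fun p : ℚ[X] => (p.map (algebraMap ℚ ℝ)).eval h) (Polynomial.sum_bernoulli n)
  simp only [Polynomial.map_sum, Polynomial.eval_finsetSum, Polynomial.map_monomial,
    Polynomial.eval_monomial] at this
  simpa [bernoulliPoly, Polynomial.smul_eq_C_mul] using this

/-- The polynomial `x ↦ ∑_{j < x} j ^ i`. -/
def powerSum (i : ℕ) : ℝ[X] :=
  Polynomial.C (1 / ((i : ℝ) + 1)) * (bernoulliPoly (i + 1) - Polynomial.C (bernoulli (i + 1) : ℝ))

lemma eval_powerSum (i N : ℕ) :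
    (powerSum i).eval (N : ℝ) = ∑ j ∈ Finset.range N, (j : ℝ) ^ i := by
  have h := congrArg (algebraMap ℚ ℝ) (Polynomial.sum_range_pow_eq_bernoulli_sub N i)
  have h2 : algebraMap ℚ ℝ ((Polynomial.bernoulli i.succ).eval (N : ℚ)) =
      (bernoulliPoly (i + 1)).eval (N : ℝ) := by
    rw [bernoulliPoly, Polynomial.eval_map_algebraMap, ← map_natCast (algebraMap ℚ ℝ) N,
      Polynomial.aeval_algebraMap_apply, Polynomial.coe_aeval_eq_eval]
  rw [map_sub, h2] at h
  simp only [powerSum, Polynomial.eval_mul, Polynomial.eval_C, Polynomial.eval_sub]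
  simp only [map_mul, map_add, map_one, map_natCast, map_sum, map_pow, eq_ratCast,
    Nat.succ_eq_add_one] at h
  rw [← h]
  have : (i : ℝ) + 1 ≠ 0 := by positivity
  field_simp

lemma coeff_powerSum (i s : ℕ) (hs : 1 ≤ s) :
    (powerSum i).coeff s = if s ≤ i + 1 then
      (bernoulli (i + 1 - s) : ℝ) * ((i + 1).choose s : ℝ) / ((i : ℝ) + 1) else 0 := by
  rw [powerSum, Polynomial.coeff_C_mul, Polynomial.coeff_sub, Polynomial.coeff_C_of_ne_zero (by omega),
    coeff_bernoulliPoly]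
  split_ifs <;> ring

/-- The coefficient of `t ^ k` in `log W_γ(x,t)`. -/
def logWCoeff (γ : ℝ) (k : ℕ) : ℝ[X] :=
  Polynomial.C ((-1) ^ k / ((k : ℝ) * (k + 1) * γ ^ k)) *
    ∑ i ∈ Finset.range (k + 2),
      Polynomial.C (((k + 1).choose i : ℝ) * (bernoulli (k + 1 - i) : ℝ) * (-γ) ^ i) * powerSum i

lemma eval_logWCoeff (γ : ℝ) (k N : ℕ) :
    (logWCoeff γ k).eval (N : ℝ) = (-1) ^ k / ((k : ℝ) * (k + 1) * γ ^ k) *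
      ∑ j ∈ Finset.range N, (bernoulliPoly (k + 1)).eval (-(j * γ)) := by
  simp only [logWCoeff, Polynomial.eval_mul, Polynomial.eval_C, Polynomial.eval_finsetSum,
    eval_powerSum, eval_bernoulliPoly, Finset.mul_sum]
  rw [Finset.sum_comm]
  refine Finset.sum_congr rfl fun j _ => Finset.sum_congr rfl fun i _ => ?_
  rw [show -((j : ℝ) * γ) = -γ * j by ring, mul_pow]
  ring

lemma choose_mul_choose_div (g s r : ℕ) (hr : r ≤ g + 1) (hs : 1 ≤ s) (hg : 1 ≤ g) :
    ((g + s).choose (s - 1 + r) : ℝ) * ((s + r).choose s : ℝ) / ((s : ℝ) + r) /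
        (((g : ℝ) + s - 1) * (g + s)) =
      ((g + s - 2)! : ℝ) / ((s ! : ℝ) * ((g + 1)! : ℝ)) * ((g + 1).choose r : ℝ) := by
  obtain ⟨s, rfl⟩ := Nat.exists_eq_add_of_le' hs
  obtain ⟨g, rfl⟩ := Nat.exists_eq_add_of_le' hg
  obtain ⟨q, hq⟩ := Nat.exists_eq_add_of_le hr
  have e1 : g + 1 + (s + 1) = s + r + q := by omega
  have e2 : s + 1 - 1 + r = s + r := by omega
  have e3 : g + 1 + (s + 1) - 2 = g + s := by omega
  have a1 : (s + r + q)! = (g + s + 2) * ((g + s + 1) * (g + s)!) := by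
    rw [← e1, show g + 1 + (s + 1) = g + s + 1 + 1 by ring, Nat.factorial_succ, Nat.factorial_succ]
  rw [e2, e3, hq, e1, Nat.cast_add_choose, Nat.cast_add_choose, Nat.cast_add_choose,
    a1, show s + 1 + r = s + r + 1 by ring, Nat.factorial_succ (s + r)]
  push_cast
  have : ((r + q)! : ℝ) ≠ 0 := by positivity
  have h1 : (g : ℝ) + 1 + (s + 1) ≠ 0 := by positivity
  have h2 : (g : ℝ) + 1 + (s + 1) - 1 ≠ 0 := by
    have : (g : ℝ) + 1 + (s + 1) - 1 = g + s + 1 := by ring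
    rw [this]; positivity
  have h3 : (s : ℝ) + 1 + r ≠ 0 := by positivity
  field_simp
  ring

/-- The coefficients of the expansion, as a sum of products of Bernoulli numbers. -/
lemma coeff_logWCoeff (γ : ℝ) (hγ : 0 < γ) (g s : ℕ) (hg : 1 ≤ g) (hs : 1 ≤ s) :
    (s ! : ℝ) * (-1) ^ s * (γ⁻¹ * (logWCoeff γ (g + s - 1)).coeff s) =
      ((g + s - 2)! : ℝ) * (-1) ^ (s + 1) / ((g + 1)! : ℝ) *
        ∑ r ∈ Finset.range (g + 2),
          ((g + 1).choose r : ℝ) * (bernoulli (g + 1 - r) : ℝ) *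
            ((-1) ^ r * (bernoulli r : ℝ) / γ ^ r) := by
  obtain ⟨k, hk⟩ : ∃ k, g + s - 1 = k := ⟨_, rfl⟩
  have hk1 : k + 2 = (s - 1) + (g + 2) := by omega
  rw [logWCoeff, hk, Polynomial.coeff_C_mul, Polynomial.finsetSum_coeff, hk1,
    Finset.sum_range_add, Finset.sum_eq_zero, zero_add]
  rotate_left
  · intro i hi
    rw [Finset.mem_range] at hi
    rw [Polynomial.coeff_C_mul, coeff_powerSum _ _ hs, if_neg (by omega), mul_zero]
  conv_rhs => rw [← Finset.sum_range_reflect]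
  simp only [Finset.mul_sum]
  refine Finset.sum_congr rfl fun r hr => ?_
  rw [Finset.mem_range] at hr
  rw [Polynomial.coeff_C_mul, coeff_powerSum _ _ hs, if_pos (by omega)]
  obtain ⟨q, hq⟩ := Nat.exists_eq_add_of_le (show r ≤ g + 1 by omega)
  have e1 : g + 2 - 1 - r = q := by omega
  have e2 : k + 1 - (s - 1 + r) = q := by omega
  have e3 : s - 1 + r + 1 - s = r := by omega
  have e4 : g + 1 - q = r := by omega
  have e5 : k + 1 = g + s := by omega
  have e6 : (g + 1).choose q = (g + 1).choose r := Nat.choose_symm_of_eq_add (by omega)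
  have key := choose_mul_choose_div g s r (by omega) hs hg
  have e7 : ((s - 1 + r : ℕ) : ℝ) + 1 = s + r := by
    rw [← Nat.cast_add_one, ← Nat.cast_add]; congr 1; omega
  have e8 : s - 1 + r + 1 = s + r := by omega
  have e9 : (k : ℝ) = g + s - 1 := by
    rw [eq_sub_iff_add_eq, ← Nat.cast_add_one, ← Nat.cast_add, e5]
  rw [e1, e2, e3, e4, e5, e6, e7, e8, e9, show (g : ℝ) + s - 1 + 1 = g + s by ring]
  have hγk : γ⁻¹ * (-γ) ^ (s - 1 + r) / γ ^ k = (-1) ^ (s - 1 + r) / γ ^ q := by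
    rw [neg_pow, div_eq_div_iff (by positivity) (by positivity), mul_assoc, mul_assoc,
      ← pow_add, mul_left_comm, show s - 1 + r + q = k + 1 by omega, pow_succ']
    field_simp
  have hsgn : (-1 : ℝ) ^ s * (-1) ^ k * (-1) ^ (s - 1 + r) = (-1) ^ (s + 1) * (-1) ^ q := by
    rw [← pow_add, ← pow_add, ← pow_add]
    refine neg_one_pow_congr ?_
    rw [Nat.even_iff, Nat.even_iff]
    omega
  calc _ = (s ! : ℝ) * ((-1 : ℝ) ^ s * (-1) ^ k) * (γ⁻¹ * (-γ) ^ (s - 1 + r) / γ ^ k) *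
        (((g + s).choose (s - 1 + r) : ℝ) * ((s + r).choose s : ℝ) / ((s : ℝ) + r) /
        (((g : ℝ) + s - 1) * (g + s))) * (bernoulli q * bernoulli r : ℝ) := by
        simp only [div_eq_mul_inv, mul_inv]; ring
    _ = (s ! : ℝ) * ((-1 : ℝ) ^ s * (-1) ^ k * (-1) ^ (s - 1 + r)) / γ ^ q *
        (((g + s - 2)! : ℝ) / ((s ! : ℝ) * ((g + 1)! : ℝ)) * ((g + 1).choose r : ℝ))
         * (bernoulli q * bernoulli r : ℝ) := by
        rw [hγk, key]; ring
    _ = _ := by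
        rw [hsgn]
        have : (s ! : ℝ) ≠ 0 := by positivity
        field_simp

lemma neg_one_pow_mul_bernoulli (r : ℕ) :
    (-1) ^ r * (bernoulli r : ℝ) = bernoulli r + if r = 1 then 1 else 0 := by
  by_cases h1 : r = 1
  · subst h1; norm_num
  · rw [if_neg h1, add_zero]
    rcases Nat.even_or_odd r with h | h
    · rw [h.neg_one_pow, one_mul]
    · rw [bernoulli_eq_zero_of_odd h (by obtain ⟨m, rfl⟩ := h; omega)]; simp

lemma sum_bernoulli_of_odd (γ : ℝ) (g : ℕ) (hg : Odd g) :
    ∑ r ∈ Finset.range (g + 2), ((g + 1).choose r : ℝ) * (bernoulli (g + 1 - r) : ℝ) *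
            ((-1) ^ r * (bernoulli r : ℝ) / γ ^ r) =
      ((g : ℝ) + 1) * (bernoulli g : ℝ) / γ ^ g +
              ∑ r ∈ Finset.range (g + 2),
                ((g + 1).choose r : ℝ) * (bernoulli (g + 1 - r) : ℝ) *
                  ((bernoulli r : ℝ) / γ ^ r) := by
  have h : ∀ r ∈ Finset.range (g + 2), ((g + 1).choose r : ℝ) * (bernoulli (g + 1 - r) : ℝ) *
            ((-1) ^ r * (bernoulli r : ℝ) / γ ^ r) =
          ((g + 1).choose r : ℝ) * (bernoulli (g + 1 - r) : ℝ) * ((bernoulli r : ℝ) / γ ^ r) +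
          if r = 1 then ((g : ℝ) + 1) * (bernoulli g : ℝ) / γ else 0 := by
    intro r _
    rw [neg_one_pow_mul_bernoulli]
    split_ifs with h
    · subst h; simp; ring
    · ring
  rw [Finset.sum_congr rfl h, Finset.sum_add_distrib, add_comm, Finset.sum_ite_eq',
    if_pos (by simp)]
  congr 1
  by_cases h1 : g = 1
  · subst h1; simp
  · rw [bernoulli_eq_zero_of_odd hg (by obtain ⟨m, rfl⟩ := hg; omega)]; simp

lemma sum_bernoulli_of_even (γ : ℝ) (g : ℕ) (hg : Even g) (hg1 : 1 ≤ g) :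
    ∑ r ∈ Finset.range (g + 2), ((g + 1).choose r : ℝ) * (bernoulli (g + 1 - r) : ℝ) *
            ((-1) ^ r * (bernoulli r : ℝ) / γ ^ r) =
      -(((g : ℝ) + 1) * (bernoulli g : ℝ) / 2 * (1 / γ ^ g - 1 / γ)) := by
  have h : ∀ r ∈ Finset.range (g + 2), ((g + 1).choose r : ℝ) * (bernoulli (g + 1 - r) : ℝ) *
            ((-1) ^ r * (bernoulli r : ℝ) / γ ^ r) =
          (if r = 1 then ((g : ℝ) + 1) * (bernoulli g : ℝ) / 2 / γ else 0) +
          if r = g then -(((g : ℝ) + 1) * (bernoulli g : ℝ) / 2 / γ ^ g) else 0 := by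
    intro r hr
    rw [Finset.mem_range] at hr
    have hg' : g ≠ 1 := by rintro rfl; simp at hg
    by_cases h1 : r = 1
    · subst h1
      rw [if_neg hg'.symm]
      simp; ring
    · rw [if_neg h1]
      by_cases h2 : r = g
      · subst h2
        simp [hg.neg_one_pow]; ring
      · rw [if_neg h2]
        rcases Nat.even_or_odd r with h | h
        · rw [bernoulli_eq_zero_of_odd (n := g + 1 - r)
            (by obtain ⟨a, rfl⟩ := h; obtain ⟨b, rfl⟩ := hg; exact ⟨b - a, by omega⟩)
            (by obtain ⟨a, rfl⟩ := h; obtain ⟨b, rfl⟩ := hg; omega)]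
          simp
        · rw [bernoulli_eq_zero_of_odd h (by obtain ⟨m, rfl⟩ := h; omega)]; simp
  rw [Finset.sum_congr rfl h, Finset.sum_add_distrib, Finset.sum_ite_eq', Finset.sum_ite_eq',
    if_pos (by simp), if_pos (by simp)]
  ring

/-- A convergent power series whose coefficients of order less than `K` vanish is `O(y ^ K)`. -/
lemma isBigO_pow_of_hasSum {e : ℕ → ℝ} {f : ℝ → ℝ} {K : ℕ} (he : ∀ k < K, e k = 0)
    (hf : ∀ᶠ y in 𝓝[>] (0 : ℝ), HasSum (fun k => e k * y ^ k) (f y)) :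
    f =O[𝓝[>] 0] fun y => y ^ K := by
  obtain ⟨r, hr, hr0⟩ := (hf.and self_mem_nhdsWithin).exists
  have hr0 : 0 < r := hr0
  obtain ⟨M, hM⟩ := hr.summable.tendsto_atTop_zero.norm.bddAbove_range
  have hM : ∀ k, |e k| * r ^ k ≤ M := fun k => by
    have := hM ⟨k, rfl⟩
    simpa [abs_mul, abs_pow, abs_of_pos hr0] using this
  have hM0 : 0 ≤ M := le_trans (by positivity) (hM 0)
  refine IsBigO.of_bound (2 * M / r ^ K) ?_
  have hlt : ∀ᶠ y in 𝓝[>] (0 : ℝ), y < r / 2 :=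
    nhdsWithin_le_nhds (Iio_mem_nhds (by positivity))
  filter_upwards [hf, hlt, self_mem_nhdsWithin] with y hy hyr hy0
  have hy0 : 0 < y := hy0
  have h1 : HasSum (fun k => e (k + K) * y ^ (k + K)) (f y) := by
    rw [← hasSum_nat_add_iff' K, Finset.sum_eq_zero, sub_zero] at hy
    · exact hy
    · intro i hi
      rw [he i (Finset.mem_range.1 hi), zero_mul]
  have h2 : HasSum (fun k : ℕ => M * (y / r) ^ K * (1 / 2 : ℝ) ^ k) (M * (y / r) ^ K * 2) :=
    hasSum_geometric_two.mul_left _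
  have h3 : ∀ k, ‖e (k + K) * y ^ (k + K)‖ ≤ M * (y / r) ^ K * (1 / 2 : ℝ) ^ k := fun k => by
    rw [norm_mul, Real.norm_eq_abs, Real.norm_eq_abs, abs_of_pos (by positivity : 0 < y ^ (k + K))]
    have : |e (k + K)| * y ^ (k + K) = |e (k + K)| * r ^ (k + K) * (y / r) ^ K * (y / r) ^ k := by
      rw [mul_assoc, mul_assoc, ← pow_add, add_comm K k, div_pow]
      field_simp
    rw [this]
    have h4 : y / r ≤ 1 / 2 := by rw [div_le_iff₀ hr0]; linarith
    have := hM (k + K)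
    gcongr
  have := h1.tsum_eq ▸ tsum_of_norm_bounded h2 h3
  rw [Real.norm_of_nonneg (by positivity : 0 ≤ y ^ K)]
  refine this.trans (le_of_eq ?_)
  rw [div_pow]; ring

/-- The coefficients of the Stirling series of `log Γ(a + h)`. -/
def stirlingCoeff (m : ℕ) (h : ℝ) : ℝ :=
  (-1) ^ (m + 1) * (bernoulliPoly (m + 1)).eval h / ((m : ℝ) * (m + 1))

lemma hasSum_log_one_add {x : ℝ} (hx : |x| < 1) :
    HasSum (fun k : ℕ => (-1) ^ (k + 1) / (k : ℝ) * x ^ k) (Real.log (1 + x)) := by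
  have h := (Real.hasSum_pow_div_log_of_abs_lt_one (x := -x) (by rwa [abs_neg])).neg
  rw [neg_neg, sub_neg_eq_add] at h
  rw [← hasSum_nat_add_iff' 1]
  simp only [Finset.range_one, Finset.sum_singleton, Nat.cast_zero, div_zero, zero_mul, sub_zero]
  refine h.congr_fun fun k => ?_
  rw [neg_pow]; push_cast; ring

lemma hasSum_log_one_add_div {x : ℝ} (hx : |x| < 1) (hx0 : x ≠ 0) :
    HasSum (fun k : ℕ => (-1) ^ k / ((k : ℝ) + 1) * x ^ k) (1 / x * Real.log (1 + x)) := by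
  have h := hasSum_log_one_add hx
  rw [← hasSum_nat_add_iff' 1] at h
  simp only [Finset.range_one, Finset.sum_singleton, Nat.cast_zero, div_zero, zero_mul,
    sub_zero] at h
  refine (h.mul_left (1 / x)).congr_fun fun k => ?_
  push_cast
  field_simp
  ring

lemma hasSum_div_one_add_pow (m : ℕ) {x : ℝ} (hx : |x| < 1) :
    HasSum (fun k : ℕ => (if m + 1 ≤ k then (-1) ^ (k - (m + 1)) * ((k - 1).choose m : ℝ) else 0) *
      x ^ k) ((x / (1 + x)) ^ (m + 1)) := by
  have h := (hasSum_choose_mul_geometric_of_norm_lt_one m (r := -x) (by simpa using hx)).mul_left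
    (x ^ (m + 1))
  rw [← hasSum_nat_add_iff' (m + 1), Finset.sum_eq_zero, sub_zero]
  · rw [sub_neg_eq_add, mul_one_div, ← div_pow] at h
    refine h.congr_fun fun k => ?_
    rw [if_pos (by omega), Nat.add_sub_cancel, neg_pow, show k + (m + 1) - 1 = k + m by omega]
    ring
  · intro i hi
    rw [if_neg (by simpa using hi), zero_mul]

lemma sum_stirlingCoeff (j : ℕ) (h : ℝ) :
    ∑ m ∈ Finset.range j, stirlingCoeff (m + 1) h * ((-1) ^ (j - m) * (j.choose m : ℝ)) =
      (-1) ^ j * (h ^ (j + 1) / (j + 1) - (h + 1 / 2) / (j + 1) + 1 / (j + 2)) := by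
  have key := sum_choose_mul_eval_bernoulliPoly (j + 1) h
  rw [Finset.sum_range_succ', Finset.sum_range_succ'] at key
  have b0 : (bernoulliPoly 0).eval h = 1 := by simp [bernoulliPoly]
  have b1 : (bernoulliPoly (0 + 1)).eval h = h - 1 / 2 := by simp [bernoulliPoly]
  rw [b0, b1] at key
  have hterm : ∀ m ∈ Finset.range j,
      stirlingCoeff (m + 1) h * ((-1) ^ (j - m) * (j.choose m : ℝ)) =
      (-1) ^ j / ((j + 1) * (j + 2)) *
        (((j + 1 + 1).choose (m + 1 + 1) : ℝ) * (bernoulliPoly (m + 1 + 1)).eval h) := by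
    intro m hm
    rw [Finset.mem_range] at hm
    have e1 := Nat.add_one_mul_choose_eq j m
    have e2 := Nat.add_one_mul_choose_eq (j + 1) (m + 1)
    have e1' : ((j : ℝ) + 1) * (j.choose m) = ((j + 1).choose (m + 1)) * (m + 1) := by
      exact_mod_cast e1
    have e2' : ((j : ℝ) + 1 + 1) * ((j + 1).choose (m + 1)) =
      ((j + 1 + 1).choose (m + 1 + 1)) * (m + 1 + 1) := by exact_mod_cast e2
    have e3 : (-1 : ℝ) ^ (m + 1 + 1) * (-1) ^ (j - m) = (-1) ^ j := by
      rw [← pow_add]; exact neg_one_pow_congr (by rw [Nat.even_iff, Nat.even_iff]; omega)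
    rw [stirlingCoeff, ← e3]
    push_cast
    have : ((j + 1 + 1).choose (m + 1 + 1) : ℝ) =
      (j + 1) * (j + 2) * j.choose m / ((m + 1) * (m + 2)) := by
      rw [eq_div_iff (by positivity)]
      linear_combination (-(m:ℝ) - 1) * e2' - ((j : ℝ) + 2) * e1'
    rw [this]
    field_simp
    ring
  rw [Finset.sum_congr rfl hterm, ← Finset.mul_sum]
  have : ∑ m ∈ Finset.range j,
      ((j + 1 + 1).choose (m + 1 + 1) : ℝ) * (bernoulliPoly (m + 1 + 1)).eval h =
      (j + 2) * h ^ (j + 1) - 1 - (j + 2) * (h - 1 / 2) := by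
    push_cast at key
    simp at key
    linarith
  rw [this]
  field_simp
  ring

lemma stirling_increment_isBigO_zero (n : ℕ) (h : ℝ) :
    (fun y : ℝ => ∑ m ∈ Finset.range n, stirlingCoeff (m + 1) h *
        ((y / (1 + y)) ^ (m + 1) - y ^ (m + 1)) -
      (Real.log (1 + h * y) + 1 - (1 / y + 1 / 2 + h) * Real.log (1 + y)))
      =O[𝓝[>] 0] fun y => y ^ (n + 2) := by
  refine isBigO_pow_of_hasSum (e := fun k => ∑ m ∈ Finset.range n, stirlingCoeff (m + 1) h *
        ((if m + 1 ≤ k then (-1) ^ (k - (m + 1)) * ((k - 1).choose m : ℝ) else 0) -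
          if k = m + 1 then 1 else 0) -
      ((-1) ^ (k + 1) / (k : ℝ) * h ^ k + (if k = 0 then 1 else 0) -
        ((-1) ^ k / ((k : ℝ) + 1) + (1 / 2 + h) * ((-1) ^ (k + 1) / (k : ℝ))))) ?_ ?_
  · intro k hk
    rcases k with _ | j
    · simp
    have h1 : ∑ m ∈ Finset.range n, stirlingCoeff (m + 1) h *
        ((if m + 1 ≤ j + 1 then (-1) ^ (j + 1 - (m + 1)) * ((j + 1 - 1).choose m : ℝ) else 0) -
          if j + 1 = m + 1 then 1 else 0) =
        ∑ m ∈ Finset.range j, stirlingCoeff (m + 1) h * ((-1) ^ (j - m) * (j.choose m : ℝ)) := by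
      symm
      refine Finset.sum_subset_zero_on_sdiff (Finset.range_subset_range.2 (by omega)) ?_ ?_
      · intro m hm
        simp only [Finset.mem_sdiff, Finset.mem_range, not_lt] at hm
        by_cases hjm : j = m
        · subst hjm; simp
        · rw [if_neg (by omega), if_neg (by omega), sub_zero, mul_zero]
      · intro m hm
        rw [Finset.mem_range] at hm
        rw [if_pos (by omega), if_neg (by omega), sub_zero, Nat.add_sub_add_right,
          Nat.add_sub_cancel]
    rw [h1, sum_stirlingCoeff, if_neg (by omega)]
    push_cast
    field_simp
    ring
  · have hlim : Tendsto (fun y : ℝ => |h * y|) (𝓝[>] 0) (𝓝 0) := by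
      have : Tendsto (fun y : ℝ => |h * y|) (𝓝 0) (𝓝 |h * 0|) := by
        apply Continuous.tendsto; fun_prop
      simpa using this.mono_left nhdsWithin_le_nhds
    filter_upwards [hlim.eventually_lt_const one_pos,
      nhdsWithin_le_nhds (Iio_mem_nhds one_pos), self_mem_nhdsWithin] with y hy1 hy2 hy0
    have hy0 : 0 < y := hy0
    have hy : |y| < 1 := by rw [abs_of_pos hy0]; exact hy2
    have s1 := hasSum_sum (s := Finset.range n) fun m _ =>
      ((hasSum_div_one_add_pow m hy).sub
        (hasSum_ite_eq (m + 1) (y ^ (m + 1)))).mul_left (stirlingCoeff (m + 1) h)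
    have s2 := ((hasSum_log_one_add hy1).add (hasSum_ite_eq 0 (1 : ℝ))).sub
      ((hasSum_log_one_add_div hy hy0.ne').add ((hasSum_log_one_add hy).mul_left (1 / 2 + h)))
    have s3 := s1.sub s2
    rw [show 1 / y * Real.log (1 + y) + (1 / 2 + h) * Real.log (1 + y) =
      (1 / y + 1 / 2 + h) * Real.log (1 + y) by ring] at s3
    refine s3.congr_fun fun k => ?_
    rw [sub_mul, Finset.sum_mul, mul_pow]
    congr 1
    · refine Finset.sum_congr rfl fun m _ => ?_
      by_cases hk : k = m + 1
      · subst hk; simp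
      · rw [if_neg hk, if_neg hk]; ring
    · by_cases hk : k = 0
      · subst hk; simp
      · rw [if_neg hk]; ring

/-- The partial sums of the Stirling series satisfy the difference equation up to `O(a ^ -(n+2))`. -/
lemma stirling_increment_isBigO (n : ℕ) (h : ℝ) :
    (fun a : ℝ => ∑ m ∈ Finset.range n, stirlingCoeff (m + 1) h *
        ((1 / (a + 1)) ^ (m + 1) - (1 / a) ^ (m + 1)) -
      (Real.log (1 + h / a) + 1 - (a + 1 / 2 + h) * Real.log (1 + 1 / a)))
      =O[atTop] fun a => (1 / a) ^ (n + 2) := by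
  refine ((stirling_increment_isBigO_zero n h).comp_tendsto tendsto_inv_atTop_nhdsGT_zero).congr'
    ?_ ?_
  · filter_upwards [eventually_gt_atTop 0] with a ha
    have : a⁻¹ / (1 + a⁻¹) = 1 / (a + 1) := by field_simp
    simp only [Function.comp_apply, this]
    simp only [inv_inv, div_eq_mul_inv, one_mul]
  · exact Eventually.of_forall fun a => by simp

/-- A function that tends to zero and whose increments are `O(a ^ -(n+2))` is `o(a ^ -n)`. -/
lemma isLittleO_of_increment {E : Type*} [NormedAddCommGroup E] {v : ℝ → E} {n : ℕ}
    (hv : Tendsto v atTop (𝓝 0))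
    (hd : (fun a => v (a + 1) - v a) =O[atTop] fun a => (1 / a) ^ (n + 2)) :
    v =o[atTop] fun a => (1 / a) ^ n := by
  obtain ⟨C, hC0, hC⟩ := hd.exists_pos
  rw [IsBigOWith] at hC
  obtain ⟨A, hA⟩ := eventually_atTop.1 hC
  have hbound : ∀ a, A ≤ a → 1 < a → ‖v a‖ ≤ C * (1 / a) ^ n * (1 / (a - 1)) := by
    intro a hAa ha
    have hpart : ∀ K : ℕ, ‖v (a + K) - v a‖ ≤
        C * (1 / a) ^ n * (1 / (a - 1) - 1 / (a + K - 1)) := by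
      intro K
      induction K with
      | zero => simp
      | succ K ih =>
        have hK : (0 : ℝ) ≤ K := K.cast_nonneg
        have h1 := hA (a + K) (by linarith)
        rw [Real.norm_of_nonneg (by positivity)] at h1
        have h2 : C * (1 / (a + K)) ^ (n + 2) ≤
            C * (1 / a) ^ n * (1 / (a + K - 1) - 1 / (a + K)) := by
          rw [pow_add, mul_assoc]
          have h3 : (1 / (a + K)) ^ n ≤ (1 / a) ^ n := by gcongr; linarith
          have h4 : (1 / (a + K)) ^ 2 ≤ 1 / (a + K - 1) - 1 / (a + K) := by
            rw [div_sub_div _ _ (by linarith) (by linarith), one_div_pow,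
              div_le_div_iff₀ (by positivity) (mul_pos (by linarith) (by linarith))]
            nlinarith
          gcongr
        have h5 : v (a + (K + 1 : ℕ)) - v a = (v (a + K + 1) - v (a + K)) + (v (a + K) - v a) := by
          push_cast; rw [← add_assoc]; abel
        rw [h5]
        refine (norm_add_le _ _).trans ?_
        push_cast
        rw [show a + ((K : ℝ) + 1) - 1 = a + K by ring]
        linarith
    have hlim : Tendsto (fun K : ℕ => ‖v (a + K) - v a‖) atTop (𝓝 ‖0 - v a‖) :=
      ((hv.comp (tendsto_atTop_add_const_left _ a tendsto_natCast_atTop_atTop)).sub_const _).norm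
    rw [zero_sub, norm_neg] at hlim
    refine le_of_tendsto hlim (Eventually.of_forall fun K => (hpart K).trans ?_)
    have hK : (0 : ℝ) ≤ K := K.cast_nonneg
    have : 0 ≤ 1 / (a + K - 1) := one_div_nonneg.2 (by linarith)
    gcongr
    linarith
  have hO : v =O[atTop] fun a => (1 / a) ^ n * (1 / (a - 1)) := by
    refine IsBigO.of_bound C ?_
    filter_upwards [eventually_ge_atTop A, eventually_gt_atTop 1] with a h1 h2
    have h3 : 0 < a - 1 := by linarith
    rw [Real.norm_of_nonneg (by positivity), ← mul_assoc]
    exact hbound a h1 h2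
  refine hO.trans_isLittleO ?_
  have h0 : Tendsto (fun a : ℝ => 1 / (a - 1)) atTop (𝓝 0) := by
    simp only [one_div]
    exact tendsto_inv_atTop_zero.comp (tendsto_atTop_add_const_right _ (-1) tendsto_id)
  have := (isBigO_refl (fun a : ℝ => (1 / a) ^ n) atTop).mul_isLittleO
    ((isLittleO_one_iff ℝ).2 h0)
  simpa using this

/-- The regularized Vandermonde weight `∏_{i ≠ j} ((u_i - u_j)² + ε)^(γ/2)`. -/
def regWeight (γ ε : ℝ) {N : ℕ} (u : Fin N → ℝ) : ℝ :=
  ∏ i, ∏ j ∈ {i}ᶜ, ((u i - u j) ^ 2 + ε) ^ (γ / 2)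

lemma regWeight_zero (γ : ℝ) {N : ℕ} (u : Fin N → ℝ) : regWeight γ 0 u = |V u| ^ (2 * γ) := by
  have h := Finset.prod_prod_Ioi_mul_eq_prod_prod_off_diag
    (fun i j : Fin N => |u j - u i| ^ γ)
  have h1 : ∀ i j : Fin N, ((u i - u j) ^ 2 + 0) ^ (γ / 2) = |u i - u j| ^ γ := fun i j => by
    rw [add_zero, ← sq_abs, ← Real.rpow_natCast, ← Real.rpow_mul (abs_nonneg _)]
    congr 1; push_cast; ring
  simp only [regWeight, h1]
  rw [← h, V, Finset.abs_prod, ← Real.finsetProd_rpow _ _ (fun i _ => abs_nonneg _)]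
  refine Finset.prod_congr rfl fun i _ => ?_
  rw [Finset.abs_prod, ← Real.finsetProd_rpow _ _ (fun i _ => abs_nonneg _)]
  refine Finset.prod_congr rfl fun j _ => ?_
  rw [abs_sub_comm (u i) (u j), two_mul]
  rcases (abs_nonneg (u j - u i)).eq_or_lt with h0 | h0
  · rcases eq_or_ne γ 0 with rfl | hγ
    · simp
    · rw [← h0, Real.zero_rpow hγ, Real.zero_rpow (by intro h; exact hγ (by linarith))]
      simp
  · rw [Real.rpow_add h0]

lemma regWeight_nonneg (γ : ℝ) {ε : ℝ} (hε : 0 ≤ ε) {N : ℕ} (u : Fin N → ℝ) :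
    0 ≤ regWeight γ ε u :=
  Finset.prod_nonneg fun i _ => Finset.prod_nonneg fun j _ => by positivity

lemma regWeight_mono {γ ε ε' : ℝ} (hγ : 0 ≤ γ) (hε : 0 ≤ ε) (h : ε ≤ ε') {N : ℕ}
    (u : Fin N → ℝ) : regWeight γ ε u ≤ regWeight γ ε' u := by
  refine Finset.prod_le_prod (fun i _ => Finset.prod_nonneg fun j _ => by positivity) fun i _ => ?_
  refine Finset.prod_le_prod (fun j _ => by positivity) fun j _ => ?_
  gcongr

lemma continuous_regWeight {γ : ℝ} (hγ : 0 ≤ γ) (N : ℕ) :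
    Continuous fun q : ℝ × (Fin N → ℝ) => regWeight γ q.1 q.2 := by
  unfold regWeight
  refine continuous_finsetProd _ fun i _ => continuous_finsetProd _ fun j _ => ?_
  exact Continuous.rpow_const (by fun_prop) fun _ => Or.inr (div_nonneg hγ zero_le_two)

lemma regWeight_comp_perm (γ ε : ℝ) {N : ℕ} (u : Fin N → ℝ) (σ : Equiv.Perm (Fin N)) :
    regWeight γ ε (u ∘ σ) = regWeight γ ε u := by
  unfold regWeight
  rw [← Equiv.prod_comp σ (fun i => ∏ j ∈ {i}ᶜ, ((u i - u j) ^ 2 + ε) ^ (γ / 2))]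
  refine Finset.prod_congr rfl fun i _ => ?_
  refine Finset.prod_equiv σ (fun j => by simp) fun j _ => rfl

lemma regWeight_zero_eq_zero {γ : ℝ} (hγ : 0 < γ) {N : ℕ} {u : Fin N → ℝ} {i j : Fin N}
    (hij : i ≠ j) (h : u i = u j) : regWeight γ 0 u = 0 := by
  refine Finset.prod_eq_zero (Finset.mem_univ i) (Finset.prod_eq_zero (i := j) ?_ ?_)
  · simpa using hij.symm
  · rw [h]; simp [hγ.ne']

/-- The variable `z = 1 - i x`. -/
def zvar (x : ℝ) : ℂ := 1 - Complex.I * x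

lemma zvar_mem_slitPlane (x : ℝ) : zvar x ∈ Complex.slitPlane := by
  left; simp [zvar]

lemma zvar_ne_zero (x : ℝ) : zvar x ≠ 0 := Complex.slitPlane_ne_zero (zvar_mem_slitPlane x)

@[fun_prop]
lemma continuous_zvar : Continuous zvar := by unfold zvar; fun_prop

lemma norm_zvar (x : ℝ) : ‖zvar x‖ = (1 + x ^ 2) ^ (1 / 2 : ℝ) := by
  rw [← Real.sqrt_eq_rpow, Complex.norm_def, Complex.normSq_apply]
  congr 1
  simp [zvar]; ring

lemma one_le_norm_zvar (x : ℝ) : 1 ≤ ‖zvar x‖ := by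
  rw [norm_zvar]; exact Real.one_le_rpow (by nlinarith [sq_nonneg x]) (by norm_num)

lemma norm_zvar_sq (x : ℝ) : ‖zvar x‖ ^ 2 = 1 + x ^ 2 := by
  rw [norm_zvar, ← Real.rpow_natCast, ← Real.rpow_mul (by positivity)]; norm_num

lemma integrable_norm_zvar_rpow {r : ℝ} (hr : r < -1) : Integrable fun x : ℝ => ‖zvar x‖ ^ r := by
  have h := integrable_rpow_neg_one_add_norm_sq (E := ℝ) (μ := volume) (r := -r)
    (by simp; linarith)
  refine h.congr (Eventually.of_forall fun x => ?_)
  simp only [norm_zvar]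
  rw [← Real.rpow_mul (by positivity), Real.norm_eq_abs, sq_abs]
  congr 1; ring

/-- The integrable function `∏ ‖z_j‖^r`, for `r < -1`. -/
lemma integrable_prod_norm_zvar_rpow (N : ℕ) {r : ℝ} (hr : r < -1) :
    Integrable fun u : Fin N → ℝ => ∏ j, ‖zvar (u j)‖ ^ r :=
  Integrable.fintype_prod fun _ => integrable_norm_zvar_rpow hr

lemma regWeight_one_le {γ : ℝ} (hγ : 0 ≤ γ) {N : ℕ} (u : Fin N → ℝ) :
    regWeight γ 1 u ≤ (2 ^ (γ / 2)) ^ (N * N) * ∏ j, ‖zvar (u j)‖ ^ (2 * γ * N) := by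
  have h1 : ∀ i j : Fin N, ((u i - u j) ^ 2 + 1) ^ (γ / 2) ≤
      2 ^ (γ / 2) * (‖zvar (u i)‖ ^ γ * ‖zvar (u j)‖ ^ γ) := fun i j => by
    have : (u i - u j) ^ 2 + 1 ≤ 2 * ((‖zvar (u i)‖ * ‖zvar (u j)‖) ^ 2) := by
      rw [mul_pow, norm_zvar_sq, norm_zvar_sq]
      nlinarith [sq_nonneg (u i + u j), sq_nonneg (u i * u j), sq_nonneg (u i), sq_nonneg (u j)]
    calc _ ≤ (2 * ((‖zvar (u i)‖ * ‖zvar (u j)‖) ^ 2)) ^ (γ / 2) := by gcongr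
      _ = _ := by
        rw [Real.mul_rpow (by positivity) (by positivity), ← Real.rpow_natCast,
          ← Real.rpow_mul (by positivity), Real.mul_rpow (by positivity) (by positivity)]
        rw [show ((2 : ℕ) : ℝ) * (γ / 2) = γ by push_cast; ring]
  have h1' : ∀ i j : Fin N, 1 ≤ 2 ^ (γ / 2) * (‖zvar (u i)‖ ^ γ * ‖zvar (u j)‖ ^ γ) := fun i j =>
    le_trans (Real.one_le_rpow (by nlinarith [sq_nonneg (u i - u j)]) (by positivity)) (h1 i j)
  calc regWeight γ 1 u
      ≤ ∏ i, ∏ j ∈ {i}ᶜ, (2 ^ (γ / 2) * (‖zvar (u i)‖ ^ γ * ‖zvar (u j)‖ ^ γ)) :=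
        Finset.prod_le_prod (fun i _ => Finset.prod_nonneg fun j _ => by positivity) fun i _ =>
          Finset.prod_le_prod (fun j _ => by positivity) fun j _ => h1 i j
    _ ≤ ∏ i, ∏ j, (2 ^ (γ / 2) * (‖zvar (u i)‖ ^ γ * ‖zvar (u j)‖ ^ γ)) :=
        Finset.prod_le_prod (fun i _ => Finset.prod_nonneg fun j _ => by positivity) fun i _ =>
          Finset.prod_le_prod_of_subset_of_one_le (Finset.subset_univ _)
            (fun j _ => by positivity) fun j _ _ => h1' i j
    _ = _ := by
        simp only [Finset.prod_mul_distrib, Finset.prod_const, Finset.card_univ, Fintype.card_fin,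
          Finset.prod_pow]
        rw [← pow_mul, ← mul_pow, ← Finset.prod_mul_distrib, ← Finset.prod_pow]
        congr 1
        refine Finset.prod_congr rfl fun j _ => ?_
        have := zero_lt_one.trans_le (one_le_norm_zvar (u j))
        rw [← Real.rpow_add this, ← Real.rpow_natCast, ← Real.rpow_mul this.le]
        congr 1; ring

/-- The one-variable factor `e^(c z) z^(-a)`. -/
def factor (a c x : ℝ) : ℂ := Complex.exp (c * zvar x) * zvar x ^ ((-a : ℝ) : ℂ)

@[fun_prop]
lemma continuous_factor (a c : ℝ) : Continuous (factor a c) := by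
  unfold factor
  refine Continuous.mul (by fun_prop) ?_
  exact continuous_zvar.cpow continuous_const fun x => zvar_mem_slitPlane x

lemma norm_factor (a c x : ℝ) : ‖factor a c x‖ = Real.exp c * ‖zvar x‖ ^ (-a) := by
  rw [factor, norm_mul, Complex.norm_cpow_real, Complex.norm_exp]
  simp [zvar]

lemma factor_mul_zvar (a c x : ℝ) : factor a c x * zvar x = factor (a - 1) c x := by
  rw [factor, factor, mul_assoc]
  congr 1
  rw [show ((-(a - 1) : ℝ) : ℂ) = ((-a : ℝ) : ℂ) + 1 by push_cast; ring,
    Complex.cpow_add _ _ (zvar_ne_zero x), Complex.cpow_one]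

lemma hasDerivAt_factor_mul_zvar (a c x : ℝ) :
    HasDerivAt (fun x => factor a c x * zvar x)
      (-Complex.I * (factor a c x * ((1 - a : ℝ) + c * zvar x))) x := by
  have hz : HasDerivAt (fun w : ℂ => 1 - Complex.I * w) (-Complex.I) (x : ℂ) := by
    simpa using ((hasDerivAt_id (x : ℂ)).const_mul Complex.I).const_sub 1
  have h := ((((hz.const_mul (c : ℂ)).cexp).mul
    (hz.cpow_const (c := ((-a : ℝ) : ℂ)) (zvar_mem_slitPlane x))).mul hz).comp_ofReal
  refine h.congr_deriv ?_
  have e : ((1 : ℂ) - Complex.I * x) ^ (((-a : ℝ) : ℂ) - 1) * (1 - Complex.I * x) =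
      (1 - Complex.I * x) ^ ((-a : ℝ) : ℂ) := by
    have h0 : (1 : ℂ) - Complex.I * x ≠ 0 := zvar_ne_zero x
    rw [Complex.cpow_sub _ _ h0, Complex.cpow_one, div_mul_cancel₀ _ h0]
  simp only [factor, zvar, Pi.mul_apply, ← e]
  push_cast
  ring

/-- The regularized integrand with the extra factor `∏_{j ∈ S} z_j`. -/
def regIntegrand (γ a c ε : ℝ) {N : ℕ} (S : Finset (Fin N)) (u : Fin N → ℝ) : ℂ :=
  (regWeight γ ε u : ℂ) * ((∏ j, factor a c (u j)) * ∏ j ∈ S, zvar (u j))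

lemma continuous_regIntegrand {γ : ℝ} (hγ : 0 ≤ γ) (a c ε : ℝ) {N : ℕ} (S : Finset (Fin N)) :
    Continuous (regIntegrand γ a c ε S) := by
  unfold regIntegrand
  have := (continuous_regWeight hγ N).comp (Continuous.prodMk_right ε)
  refine (Complex.continuous_ofReal.comp this).mul ?_
  fun_prop

lemma norm_regIntegrand_le {γ a c ε : ℝ} (hγ : 0 ≤ γ) (hε : 0 ≤ ε) (hε1 : ε ≤ 1) {N : ℕ}
    (S : Finset (Fin N)) (u : Fin N → ℝ) :
    ‖regIntegrand γ a c ε S u‖ ≤ (2 ^ (γ / 2)) ^ (N * N) * Real.exp c ^ N *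
      ∏ j, ‖zvar (u j)‖ ^ (2 * γ * N + 1 - a) := by
  have h1 : ∏ j ∈ S, ‖zvar (u j)‖ ≤ ∏ j, ‖zvar (u j)‖ :=
    Finset.prod_le_prod_of_subset_of_one_le (Finset.subset_univ _)
      (fun j _ => by positivity) fun j _ _ => one_le_norm_zvar _
  have h2 := (regWeight_mono hγ hε hε1 u).trans (regWeight_one_le hγ u)
  rw [regIntegrand, norm_mul, norm_mul, norm_prod, norm_prod, Complex.norm_real,
    Real.norm_of_nonneg (regWeight_nonneg γ hε u)]
  simp only [norm_factor]
  calc _ ≤ ((2 ^ (γ / 2)) ^ (N * N) * ∏ j, ‖zvar (u j)‖ ^ (2 * γ * N)) *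
        ((∏ j, Real.exp c * ‖zvar (u j)‖ ^ (-a)) * ∏ j, ‖zvar (u j)‖) := by
        gcongr
    _ = _ := by
        rw [Finset.prod_mul_distrib, Finset.prod_const, Finset.card_univ, Fintype.card_fin]
        have : ∀ j, ‖zvar (u j)‖ ^ (2 * γ * N + 1 - a) =
            ‖zvar (u j)‖ ^ (2 * γ * N) * (‖zvar (u j)‖ ^ (-a) * ‖zvar (u j)‖) := fun j => by
          have := zero_lt_one.trans_le (one_le_norm_zvar (u j))
          rw [← Real.rpow_add_one this.ne', ← Real.rpow_add this]
          congr 1; ring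
        simp only [this, Finset.prod_mul_distrib]
        ring

lemma integrable_of_norm_le_prod {γ a : ℝ} {N : ℕ} (ha : 2 * γ * N + 2 < a)
    {f : (Fin N → ℝ) → ℂ} (hf : Continuous f) {C : ℝ}
    (h : ∀ u, ‖f u‖ ≤ C * ∏ j, ‖zvar (u j)‖ ^ (2 * γ * N + 1 - a)) : Integrable f :=
  ((integrable_prod_norm_zvar_rpow N (by linarith)).const_mul C).mono' hf.aestronglyMeasurable
    (Eventually.of_forall h)

lemma integrable_regIntegrand {γ a ε : ℝ} (c : ℝ) {N : ℕ} (hγ : 0 ≤ γ) (ha : 2 * γ * N + 2 < a)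
    (hε : 0 ≤ ε) (hε1 : ε ≤ 1) (S : Finset (Fin N)) : Integrable (regIntegrand γ a c ε S) :=
  integrable_of_norm_le_prod ha (continuous_regIntegrand hγ a c ε S)
    fun u => norm_regIntegrand_le hγ hε hε1 S u

lemma integral_comp_perm {N : ℕ} (σ : Equiv.Perm (Fin N)) (f : (Fin N → ℝ) → ℂ) :
    ∫ u : Fin N → ℝ, f (u ∘ σ) = ∫ u, f u := by
  have h := (volume_measurePreserving_piCongrLeft (fun _ : Fin N => ℝ) σ.symm).integral_comp' f
  rw [← h]
  congr 1
  ext u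
  congr 1
  ext i
  have := Equiv.piCongrLeft_apply_apply (fun _ : Fin N => ℝ) σ.symm u (σ i)
  rw [Equiv.symm_apply_apply] at this
  exact this.symm

lemma regIntegrand_comp_perm (γ a c ε : ℝ) {N : ℕ} (S : Finset (Fin N)) (u : Fin N → ℝ)
    (σ : Equiv.Perm (Fin N)) :
    regIntegrand γ a c ε S (u ∘ σ) = regIntegrand γ a c ε (S.map σ.toEmbedding) u := by
  simp only [regIntegrand, regWeight_comp_perm, Function.comp_apply, Finset.prod_map,
    Equiv.coe_toEmbedding]
  rw [Equiv.prod_comp σ (fun j => factor a c (u j))]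

lemma regIntegrand_insert (γ a c ε : ℝ) {N : ℕ} {S : Finset (Fin N)} {p : Fin N} (hp : p ∉ S)
    (u : Fin N → ℝ) :
    regIntegrand γ a c ε (insert p S) u = regIntegrand γ a c ε S u * zvar (u p) := by
  rw [regIntegrand, regIntegrand, Finset.prod_insert hp]
  ring

/-- The logarithmic interaction kernel `x / (x² + ε)`. -/
def kernel (ε x : ℝ) : ℝ := x / (x ^ 2 + ε)

lemma kernel_neg (ε x : ℝ) : kernel ε (-x) = -kernel ε x := by
  simp [kernel, neg_div]

lemma continuous_kernel {ε : ℝ} (hε : 0 < ε) : Continuous (kernel ε) := by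
  unfold kernel
  exact continuous_id.div (by fun_prop) fun x => by positivity

lemma abs_kernel_le {ε : ℝ} (hε : 0 < ε) (hε1 : ε ≤ 1) (x : ℝ) : |kernel ε x| ≤ 1 / ε := by
  rw [kernel, abs_div, abs_of_pos (by positivity : 0 < x ^ 2 + ε),
    div_le_div_iff₀ (by positivity) hε, one_mul, ← sq_abs]
  have := abs_nonneg x
  nlinarith [sq_nonneg (|x| - 1), sq_nonneg |x|]

lemma hasDerivAt_regWeight_line (γ : ℝ) {ε : ℝ} (hε : 0 < ε) {N : ℕ} (u : Fin N → ℝ) (p : Fin N) :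
    HasDerivAt (fun s : ℝ => regWeight γ ε (u + s • Pi.single p 1))
      (regWeight γ ε u * (2 * γ * ∑ j ∈ {p}ᶜ, kernel ε (u p - u j))) 0 := by
  let δ : Fin N → ℝ := Pi.single p 1
  have hform : ∀ s : ℝ, regWeight γ ε (u + s • Pi.single p 1) =
      Real.exp (∑ i, ∑ j ∈ {i}ᶜ,
        Real.log ((u i + s * δ i - (u j + s * δ j)) ^ 2 + ε) * (γ / 2)) := fun s => by
    rw [Real.exp_sum]
    refine Finset.prod_congr rfl fun i _ => ?_
    rw [Real.exp_sum]
    refine Finset.prod_congr rfl fun j _ => ?_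
    rw [Real.rpow_def_of_pos (by positivity)]
    simp [δ]
  have hd : ∀ i j : Fin N, HasDerivAt (fun s : ℝ =>
      Real.log ((u i + s * δ i - (u j + s * δ j)) ^ 2 + ε) * (γ / 2))
      ((δ i - δ j) * (γ * kernel ε (u i - u j))) 0 := fun i j => by
    have h1 : HasDerivAt (fun s : ℝ => u i + s * δ i - (u j + s * δ j)) (δ i - δ j) 0 := by
      have := (((hasDerivAt_id (0 : ℝ)).mul_const (δ i)).const_add (u i)).fun_sub
        (((hasDerivAt_id (0 : ℝ)).mul_const (δ j)).const_add (u j))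
      simpa using this
    have h2 := (((h1.pow 2).add_const ε).log (by simp; positivity)).mul_const (γ / 2)
    refine h2.congr_deriv ?_
    simp [kernel]
    ring
  have hs := (HasDerivAt.fun_sum (u := Finset.univ) fun i _ =>
    HasDerivAt.fun_sum (u := ({i}ᶜ : Finset (Fin N))) fun j _ => hd i j).exp
  rw [funext hform]
  refine hs.congr_deriv ?_
  rw [← hform 0, zero_smul, add_zero]
  congr 1
  have hanti : ∑ i : Fin N, ∑ j ∈ {i}ᶜ, (δ i - δ j) * (γ * kernel ε (u i - u j)) =
      ∑ i : Fin N, ∑ j : Fin N, (δ i - δ j) * (γ * kernel ε (u i - u j)) := by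
    refine Finset.sum_congr rfl fun i _ => ?_
    refine Finset.sum_subset (Finset.subset_univ _) fun j _ hj => ?_
    have : j = i := by simpa using hj
    rw [this, sub_self, zero_mul]
  have h1 : ∑ i : Fin N, ∑ j : Fin N, δ i * (γ * kernel ε (u i - u j)) =
      γ * ∑ j, kernel ε (u p - u j) := by
    rw [Finset.sum_eq_single p]
    · simp [δ, Finset.mul_sum]
    · intro i _ hi; simp [δ, Pi.single_eq_of_ne hi]
    · simp
  have h2 : ∑ i : Fin N, ∑ j : Fin N, δ j * (γ * kernel ε (u i - u j)) =
      -(γ * ∑ j, kernel ε (u p - u j)) := by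
    rw [Finset.sum_comm, ← h1, ← Finset.sum_neg_distrib]
    refine Finset.sum_congr rfl fun i _ => ?_
    rw [← Finset.sum_neg_distrib]
    refine Finset.sum_congr rfl fun j _ => ?_
    rw [← neg_sub (u i) (u j), kernel_neg]; ring
  have h3 : ∑ j ∈ {p}ᶜ, kernel ε (u p - u j) = ∑ j, kernel ε (u p - u j) := by
    refine Finset.sum_subset (Finset.subset_univ _) fun j _ hj => ?_
    have : j = p := by simpa using hj
    rw [this]; simp [kernel]
  rw [hanti, h3]
  simp only [sub_mul, Finset.sum_sub_distrib]
  rw [h1, h2]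
  ring

lemma hasLineDerivAt_regIntegrand (γ a c : ℝ) {ε : ℝ} (hε : 0 < ε) {N : ℕ} {S : Finset (Fin N)}
    {p : Fin N} (hp : p ∉ S) (u : Fin N → ℝ) :
    HasLineDerivAt ℝ (regIntegrand γ a c ε (insert p S))
      (-Complex.I * (((1 - a : ℝ) : ℂ) * regIntegrand γ a c ε S u +
          c * regIntegrand γ a c ε (insert p S) u) +
        2 * γ * ∑ j ∈ {p}ᶜ, (kernel ε (u p - u j) : ℂ) * regIntegrand γ a c ε (insert p S) u)
      u (Pi.single p 1) := by
  unfold HasLineDerivAt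
  set R : ℂ := (∏ j ∈ {p}ᶜ, factor a c (u j)) * ∏ j ∈ S, zvar (u j) with hR
  have hform : ∀ s : ℝ, regIntegrand γ a c ε (insert p S) (u + s • Pi.single p 1) =
      (regWeight γ ε (u + s • Pi.single p 1) : ℂ) *
        (factor a c (u p + s) * zvar (u p + s) * R) := fun s => by
    have hne : ∀ j, j ≠ p → (u + s • (Pi.single p 1 : Fin N → ℝ)) j = u j := fun j hj => by
      simp [Pi.single_eq_of_ne hj]
    have heq : (u + s • (Pi.single p 1 : Fin N → ℝ)) p = u p + s := by simp
    rw [regIntegrand, Finset.prod_insert hp, ← Finset.prod_mul_prod_compl {p} (fun j => factor a c _),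
      Finset.prod_singleton, heq, hR]
    rw [Finset.prod_congr rfl fun j hj => by rw [hne j (by simpa using hj)],
      Finset.prod_congr (s₁ := S) rfl fun j hj => by rw [hne j (by rintro rfl; exact hp hj)]]
    ring
  have hS : regIntegrand γ a c ε S u = (regWeight γ ε u : ℂ) * (factor a c (u p) * R) := by
    rw [regIntegrand, ← Finset.prod_mul_prod_compl {p} (fun j => factor a c _), Finset.prod_singleton, hR]
    ring
  have h1 := (hasDerivAt_regWeight_line γ hε u p).ofReal_comp
  have h2 : HasDerivAt (fun s : ℝ => factor a c (u p + s) * zvar (u p + s))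
      (-Complex.I * (factor a c (u p) * ((1 - a : ℝ) + c * zvar (u p)))) 0 :=
    HasDerivAt.comp_const_add (u p) 0 (by
      rw [add_zero]; exact hasDerivAt_factor_mul_zvar a c (u p))
  have h3 := h1.mul (h2.mul_const R)
  rw [funext hform]
  refine h3.congr_deriv ?_
  rw [regIntegrand_insert γ a c ε hp, hS, zero_smul, add_zero, add_zero, ← Finset.sum_mul]
  push_cast
  ring

lemma integral_lineDeriv_eq_zero {N : ℕ} {f f' : (Fin N → ℝ) → ℂ} {v : Fin N → ℝ}
    (hf : Integrable f) (hf' : Integrable f') (h : ∀ u, HasLineDerivAt ℝ f (f' u) u v) :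
    ∫ u, f' u = 0 := by
  have := integral_bilinear_hasLineDerivAt_right_eq_neg_left_of_integrable
    (μ := (volume : Measure (Fin N → ℝ)))
    (f := f) (f' := f') (g := fun _ => (1 : ℂ)) (g' := fun _ => 0) (v := v)
    (B := ContinuousLinearMap.mul ℝ ℂ) (by simpa using hf') (by simp) (by simpa using hf)
    (fun x _ => h x) (fun x _ => by unfold HasLineDerivAt; exact hasDerivAt_const 0 1)
  simpa using this.symm

lemma integrable_kernel_mul {γ a ε : ℝ} (c : ℝ) {N : ℕ} (hγ : 0 ≤ γ) (ha : 2 * γ * N + 2 < a)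
    (hε : 0 < ε) (hε1 : ε ≤ 1) (S : Finset (Fin N)) (i j : Fin N) :
    Integrable fun u : Fin N → ℝ => (kernel ε (u i - u j) : ℂ) * regIntegrand γ a c ε S u := by
  refine (integrable_regIntegrand c hγ ha hε.le hε1 S).bdd_mul (c := 1 / ε) ?_ ?_
  · have := (continuous_kernel hε).comp (f := fun u : Fin N → ℝ => u i - u j) (by fun_prop)
    exact (Complex.continuous_ofReal.comp this).aestronglyMeasurable
  · refine Eventually.of_forall fun u => ?_
    rw [Complex.norm_real]
    exact abs_kernel_le hε hε1 _

lemma integral_kernel_mul_of_mem (γ a c ε : ℝ) {N : ℕ} {S : Finset (Fin N)} {p j : Fin N}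
    (hp : p ∈ S) (hj : j ∈ S) :
    ∫ u : Fin N → ℝ, (kernel ε (u p - u j) : ℂ) * regIntegrand γ a c ε S u = 0 := by
  have h := integral_comp_perm (Equiv.swap p j)
    (fun u => (kernel ε (u p - u j) : ℂ) * regIntegrand γ a c ε S u)
  have hS : S.map (Equiv.swap p j).toEmbedding = S := by
    ext i
    simp only [Finset.mem_map_equiv, Equiv.symm_swap]
    rcases eq_or_ne i p with rfl | h1
    · simp [hp, hj]
    · rcases eq_or_ne i j with rfl | h2
      · simp [hp, hj]
      · rw [Equiv.swap_apply_of_ne_of_ne h1 h2]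
  simp only [regIntegrand_comp_perm, hS, Function.comp_apply, Equiv.swap_apply_left,
    Equiv.swap_apply_right] at h
  have h2 : ∀ u : Fin N → ℝ, (kernel ε (u j - u p) : ℂ) * regIntegrand γ a c ε S u =
      -((kernel ε (u p - u j) : ℂ) * regIntegrand γ a c ε S u) := fun u => by
    rw [← neg_sub (u p), kernel_neg]; push_cast; ring
  simp only [h2, integral_neg] at h
  exact self_eq_neg.1 h.symm

lemma integral_kernel_mul_of_notMem {γ a ε : ℝ} (c : ℝ) {N : ℕ} (hγ : 0 ≤ γ)
    (ha : 2 * γ * N + 2 < a) (hε : 0 < ε) (hε1 : ε ≤ 1) {S : Finset (Fin N)} {p j : Fin N}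
    (hp : p ∉ S) (hj : j ∉ S) :
    ∫ u : Fin N → ℝ, (kernel ε (u p - u j) : ℂ) * regIntegrand γ a c ε (insert p S) u =
      -(Complex.I / 2) * ∫ u : Fin N → ℝ,
        (((u p - u j) * kernel ε (u p - u j) : ℝ) : ℂ) * regIntegrand γ a c ε S u := by
  have h := integral_comp_perm (Equiv.swap p j)
    (fun u => (kernel ε (u p - u j) : ℂ) * regIntegrand γ a c ε (insert p S) u)
  have hS : (insert p S).map (Equiv.swap p j).toEmbedding = insert j S := by
    rw [Finset.map_insert]
    congr 1
    · simp
    · ext i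
      simp only [Finset.mem_map_equiv, Equiv.symm_swap]
      rcases eq_or_ne i p with rfl | h1
      · simp [hp, hj]
      · rcases eq_or_ne i j with rfl | h2
        · simp [hp, hj]
        · rw [Equiv.swap_apply_of_ne_of_ne h1 h2]
  simp only [regIntegrand_comp_perm, hS, Function.comp_apply, Equiv.swap_apply_left,
    Equiv.swap_apply_right] at h
  have i1 := integrable_kernel_mul c hγ ha hε hε1 (insert p S) p j
  have i2 := integrable_kernel_mul c hγ ha hε hε1 (insert j S) j p
  have h2 : ∫ u : Fin N → ℝ, ((kernel ε (u p - u j) : ℂ) * regIntegrand γ a c ε (insert p S) u +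
      (kernel ε (u j - u p) : ℂ) * regIntegrand γ a c ε (insert j S) u) =
      -Complex.I * ∫ u : Fin N → ℝ,
        (((u p - u j) * kernel ε (u p - u j) : ℝ) : ℂ) * regIntegrand γ a c ε S u := by
    rw [← integral_const_mul]
    congr 1
    ext u
    rw [regIntegrand_insert γ a c ε hp, regIntegrand_insert γ a c ε hj, ← neg_sub (u p), kernel_neg]
    simp only [zvar]
    push_cast
    ring
  rw [integral_add i1 i2, h] at h2
  linear_combination h2 / 2

/-- Aomoto's recursion for the regularized weight. -/
lemma regularized_recursion {γ a ε : ℝ} (c : ℝ) {N : ℕ} (hγ : 0 ≤ γ)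
    (ha : 2 * γ * N + 2 < a) (hε : 0 < ε) (hε1 : ε ≤ 1) {S : Finset (Fin N)} {p : Fin N}
    (hp : p ∉ S) :
    ((1 - a : ℝ) : ℂ) * (∫ u, regIntegrand γ a c ε S u) +
      c * (∫ u, regIntegrand γ a c ε (insert p S) u) +
      γ * ∑ j ∈ (insert p S)ᶜ, ∫ u : Fin N → ℝ,
        (((u p - u j) * kernel ε (u p - u j) : ℝ) : ℂ) * regIntegrand γ a c ε S u = 0 := by
  have i1 := integrable_regIntegrand c hγ ha hε.le hε1 S
  have i2 := integrable_regIntegrand c hγ ha hε.le hε1 (insert p S)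
  have i3 := integrable_finsetSum ({p}ᶜ : Finset (Fin N)) fun j _ =>
    integrable_kernel_mul c hγ ha hε hε1 (insert p S) p j
  have i4 := ((i1.const_mul ((1 - a : ℝ) : ℂ)).add (i2.const_mul (c : ℂ))).const_mul (-Complex.I)
  have i5 := i3.const_mul (2 * γ : ℂ)
  have h := integral_lineDeriv_eq_zero i2 (i4.add i5) (hasLineDerivAt_regIntegrand γ a c hε hp)
  have h1 := (integral_add i4 i5).symm.trans h
  have h2 := integral_add (i1.const_mul ((1 - a : ℝ) : ℂ)) (i2.const_mul (c : ℂ))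
  rw [integral_const_mul, integral_const_mul] at h2
  rw [integral_const_mul, integral_const_mul,
    integral_finsetSum _ fun j _ => integrable_kernel_mul c hγ ha hε hε1 (insert p S) p j] at h1
  erw [h2] at h1
  have hsum : ∑ j ∈ {p}ᶜ, ∫ u : Fin N → ℝ,
      (kernel ε (u p - u j) : ℂ) * regIntegrand γ a c ε (insert p S) u =
      ∑ j ∈ (insert p S)ᶜ, -(Complex.I / 2) * ∫ u : Fin N → ℝ,
        (((u p - u j) * kernel ε (u p - u j) : ℝ) : ℂ) * regIntegrand γ a c ε S u := by
    symm
    refine Finset.sum_subset_zero_on_sdiff ?_ ?_ ?_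
    · exact Finset.compl_subset_compl.2 (by simp)
    · intro j hj
      refine integral_kernel_mul_of_mem γ a c ε (Finset.mem_insert_self p S) ?_
      by_contra hjS
      exact (Finset.mem_sdiff.1 hj).2 (Finset.mem_compl.2 hjS)
    · intro j hj
      rw [integral_kernel_mul_of_notMem c hγ ha hε hε1 hp]
      intro hjS
      exact (Finset.mem_compl.1 hj) (Finset.mem_insert_of_mem hjS)
  rw [hsum, ← Finset.mul_sum] at h1
  linear_combination Complex.I * h1 + (((1 - a : ℝ) : ℂ) * (∫ u, regIntegrand γ a c ε S u) +
      c * (∫ u, regIntegrand γ a c ε (insert p S) u) +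
      γ * ∑ j ∈ (insert p S)ᶜ, ∫ u : Fin N → ℝ,
        (((u p - u j) * kernel ε (u p - u j) : ℝ) : ℂ) * regIntegrand γ a c ε S u) *
      Complex.I_sq

lemma mul_kernel_nonneg {ε : ℝ} (hε : 0 < ε) (x : ℝ) : 0 ≤ x * kernel ε x := by
  rw [kernel, mul_div_assoc', ← sq]; positivity

lemma mul_kernel_le_one {ε : ℝ} (hε : 0 < ε) (x : ℝ) : x * kernel ε x ≤ 1 := by
  rw [kernel, mul_div_assoc', ← sq, div_le_one (by positivity)]; linarith

lemma tendsto_mul_kernel {x : ℝ} (hx : x ≠ 0) :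
    Tendsto (fun ε => x * kernel ε x) (𝓝[>] 0) (𝓝 1) := by
  have h : ContinuousAt (fun ε : ℝ => x * kernel ε x) 0 := by
    unfold kernel
    refine continuousAt_const.mul (continuousAt_const.div (by fun_prop) ?_)
    simpa using hx
  have h0 : x * kernel 0 x = 1 := by simp [kernel]; field_simp
  have := h.tendsto
  rw [h0] at this
  exact this.mono_left nhdsWithin_le_nhds

lemma tendsto_regIntegrand {γ : ℝ} (hγ : 0 ≤ γ) (a c : ℝ) {N : ℕ} (S : Finset (Fin N))
    (u : Fin N → ℝ) :
    Tendsto (fun ε => regIntegrand γ a c ε S u) (𝓝[>] 0) (𝓝 (regIntegrand γ a c 0 S u)) := by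
  have h := (continuous_regWeight hγ N).comp (Continuous.prodMk_left u)
  have h2 := (Complex.continuous_ofReal.comp h).tendsto 0
  exact (h2.mono_left nhdsWithin_le_nhds).mul_const _

lemma tendsto_mul_kernel_mul_regIntegrand {γ : ℝ} (hγ : 0 < γ) (a c : ℝ) {N : ℕ}
    (S : Finset (Fin N)) (u : Fin N → ℝ) {p j : Fin N} (hpj : p ≠ j) :
    Tendsto (fun ε => (((u p - u j) * kernel ε (u p - u j) : ℝ) : ℂ) * regIntegrand γ a c ε S u)
      (𝓝[>] 0) (𝓝 (regIntegrand γ a c 0 S u)) := by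
  by_cases h : u p = u j
  · have : regIntegrand γ a c 0 S u = 0 := by
      rw [regIntegrand, regWeight_zero_eq_zero hγ hpj h]; simp
    rw [this]
    simp [h]
  · have h1 := (Complex.continuous_ofReal.tendsto 1).comp (tendsto_mul_kernel (sub_ne_zero.2 h))
    simpa using h1.mul (tendsto_regIntegrand hγ.le a c S u)

lemma eventually_mem_Ioc : ∀ᶠ ε in 𝓝[>] (0 : ℝ), 0 < ε ∧ ε ≤ 1 :=
  Ioc_mem_nhdsGT one_pos

/-- The integral of `|V|^(2γ) ∏ e^(c z_j) z_j^(-a) ∏_{j ∈ S} z_j`. -/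
def corrInt (γ a c : ℝ) {N : ℕ} (S : Finset (Fin N)) : ℂ := ∫ u, regIntegrand γ a c 0 S u

/-- Aomoto's recursion. -/
lemma corrInt_insert {γ a : ℝ} (c : ℝ) {N : ℕ} (hγ : 0 < γ) (ha : 2 * γ * N + 2 < a)
    {S : Finset (Fin N)} {p : Fin N} (hp : p ∉ S) :
    c * corrInt γ a c (insert p S) =
      ((a - 1 - γ * (N - 1 - S.card) : ℝ) : ℂ) * corrInt γ a c S := by
  set C : ℝ := (2 ^ (γ / 2)) ^ (N * N) * Real.exp c ^ N
  set B : (Fin N → ℝ) → ℝ := fun u => C * ∏ j, ‖zvar (u j)‖ ^ (2 * γ * N + 1 - a)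
  have hB : Integrable B := (integrable_prod_norm_zvar_rpow N (by linarith)).const_mul C
  have lim1 : ∀ T : Finset (Fin N), Tendsto (fun ε => ∫ u, regIntegrand γ a c ε T u)
      (𝓝[>] 0) (𝓝 (corrInt γ a c T)) := fun T => by
    refine tendsto_integral_filter_of_dominated_convergence B ?_ ?_ hB
      (Eventually.of_forall fun u => tendsto_regIntegrand hγ.le a c T u)
    · exact Eventually.of_forall fun ε =>
        (continuous_regIntegrand hγ.le a c ε T).aestronglyMeasurable
    · filter_upwards [eventually_mem_Ioc] with ε hε
      exact Eventually.of_forall fun u => norm_regIntegrand_le hγ.le hε.1.le hε.2 T u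
  have lim2 : ∀ j ∈ (insert p S)ᶜ, Tendsto (fun ε => ∫ u : Fin N → ℝ,
      (((u p - u j) * kernel ε (u p - u j) : ℝ) : ℂ) * regIntegrand γ a c ε S u)
      (𝓝[>] 0) (𝓝 (corrInt γ a c S)) := fun j hj => by
    have hpj : p ≠ j := by rintro rfl; simp at hj
    refine tendsto_integral_filter_of_dominated_convergence B ?_ ?_ hB
      (Eventually.of_forall fun u => tendsto_mul_kernel_mul_regIntegrand hγ a c S u hpj)
    · filter_upwards [eventually_mem_Ioc] with ε hε
      refine Continuous.aestronglyMeasurable (Continuous.mul ?_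
        (continuous_regIntegrand hγ.le a c ε S))
      refine Complex.continuous_ofReal.comp (Continuous.mul (by fun_prop) ?_)
      exact (continuous_kernel hε.1).comp (f := fun u : Fin N → ℝ => u p - u j) (by fun_prop)
    · filter_upwards [eventually_mem_Ioc] with ε hε
      refine Eventually.of_forall fun u => ?_
      rw [norm_mul, Complex.norm_real, Real.norm_of_nonneg (mul_kernel_nonneg hε.1 _)]
      exact (mul_le_of_le_one_left (norm_nonneg _) (mul_kernel_le_one hε.1 _)).trans
        (norm_regIntegrand_le hγ.le hε.1.le hε.2 S u)
  have lim := (((lim1 S).const_mul ((1 - a : ℝ) : ℂ)).add ((lim1 (insert p S)).const_mul (c : ℂ))).add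
    ((tendsto_finsetSum _ lim2).const_mul (γ : ℂ))
  have hzero := tendsto_nhds_unique (lim.congr' (eventually_mem_Ioc.mono fun ε hε =>
    regularized_recursion c hγ.le ha hε.1 hε.2 hp)) tendsto_const_nhds
  have hcard : (((insert p S)ᶜ.card : ℕ) : ℂ) = N - 1 - S.card := by
    have h1 := Finset.card_add_card_compl (insert p S)
    rw [Finset.card_insert_of_notMem hp, Fintype.card_fin] at h1
    have h2 : ((S.card : ℂ) + 1 + ((insert p S)ᶜ.card : ℕ)) = N := by exact_mod_cast h1
    linear_combination h2
  rw [Finset.sum_const, nsmul_eq_mul, hcard] at hzero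
  push_cast at hzero ⊢
  linear_combination hzero

lemma pow_card_mul_corrInt {γ a : ℝ} (c : ℝ) {N : ℕ} (hγ : 0 < γ) (ha : 2 * γ * N + 2 < a)
    (S : Finset (Fin N)) :
    (c : ℂ) ^ S.card * corrInt γ a c S =
      ((∏ i ∈ Finset.range S.card, (a - 1 - γ * (N - 1 - i)) : ℝ) : ℂ) * corrInt γ a c (∅ : Finset (Fin N)) := by
  induction S using Finset.induction_on with
  | empty => simp
  | insert p S hp ih =>
    rw [Finset.card_insert_of_notMem hp, Finset.prod_range_succ, pow_succ, mul_assoc,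
      corrInt_insert c hγ ha hp, mul_left_comm, ih]
    push_cast
    ring

lemma corrInt_univ (γ a c : ℝ) (N : ℕ) :
    corrInt γ a c (Finset.univ : Finset (Fin N)) = corrInt γ (a - 1) c (∅ : Finset (Fin N)) := by
  unfold corrInt regIntegrand
  congr 1
  ext u
  rw [← Finset.prod_mul_distrib]
  simp [factor_mul_zvar]

/-- The recursion in the exponent. -/
lemma corrInt_sub_one {γ a : ℝ} (c : ℝ) {N : ℕ} (hγ : 0 < γ) (ha : 2 * γ * N + 2 < a) :
    (c : ℂ) ^ N * corrInt γ (a - 1) c (∅ : Finset (Fin N)) =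
      ((∏ i ∈ Finset.range N, (a - 1 - γ * i) : ℝ) : ℂ) * corrInt γ a c (∅ : Finset (Fin N)) := by
  have h := pow_card_mul_corrInt c hγ ha (Finset.univ : Finset (Fin N))
  rw [Finset.card_univ, Fintype.card_fin, corrInt_univ] at h
  rw [h, ← Finset.prod_range_reflect (fun i : ℕ => a - 1 - γ * i)]
  congr 2
  refine Finset.prod_congr rfl fun i hi => ?_
  rw [Finset.mem_range] at hi
  rw [Nat.sub_sub, Nat.cast_sub (by omega)]
  push_cast
  ring

lemma hasDerivAt_regIntegrand (γ a c ε : ℝ) {N : ℕ} (u : Fin N → ℝ) :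
    HasDerivAt (fun c : ℝ => regIntegrand γ a c ε ∅ u) (∑ p, regIntegrand γ a c ε {p} u) c := by
  have hform : ∀ c : ℝ, regIntegrand γ a c ε ∅ u = (regWeight γ ε u : ℂ) *
      ((∏ j, zvar (u j) ^ ((-a : ℝ) : ℂ)) * Complex.exp (c * ∑ j, zvar (u j))) := fun c => by
    simp only [regIntegrand, factor, Finset.prod_empty, mul_one, Finset.prod_mul_distrib]
    rw [← Complex.exp_sum, Finset.mul_sum]
    ring
  have h1 : HasDerivAt (fun c : ℝ => Complex.exp (c * ∑ j, zvar (u j)))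
      (Complex.exp (c * ∑ j, zvar (u j)) * ∑ j, zvar (u j)) c := by
    have := ((hasDerivAt_id (c : ℂ)).mul_const (∑ j, zvar (u j))).cexp.comp_ofReal
    simpa using this
  have hp : ∀ p, regIntegrand γ a c ε {p} u = regIntegrand γ a c ε ∅ u * zvar (u p) := fun p => by
    rw [← regIntegrand_insert γ a c ε (Finset.notMem_empty p)]; rfl
  simp only [hp, ← Finset.mul_sum]
  rw [funext hform]
  refine ((h1.const_mul _).const_mul _).congr_deriv ?_
  rw [hform]
  ring

lemma hasDerivAt_corrInt {γ a : ℝ} (c : ℝ) {N : ℕ} (hγ : 0 < γ) (ha : 2 * γ * N + 2 < a) :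
    HasDerivAt (fun c => corrInt γ a c (∅ : Finset (Fin N)))
      (∑ p : Fin N, corrInt γ a c {p}) c := by
  set C : ℝ := N * ((2 ^ (γ / 2)) ^ (N * N) * Real.exp (c + 1) ^ N)
  set B : (Fin N → ℝ) → ℝ := fun u => C * ∏ j, ‖zvar (u j)‖ ^ (2 * γ * N + 1 - a)
  have hB : Integrable B := (integrable_prod_norm_zvar_rpow N (by linarith)).const_mul C
  have hint : ∀ (c : ℝ) (S : Finset (Fin N)), Integrable (regIntegrand γ a c 0 S) := fun c S =>
    integrable_regIntegrand c hγ.le ha le_rfl zero_le_one S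
  have h := (hasDerivAt_integral_of_dominated_loc_of_deriv_le (μ := volume) (bound := B)
    (F := fun (c : ℝ) (u : Fin N → ℝ) => regIntegrand γ a c 0 ∅ u)
    (F' := fun c u => ∑ p, regIntegrand γ a c 0 {p} u)
    (Metric.ball_mem_nhds c one_pos)
    (Eventually.of_forall fun c => (hint c ∅).aestronglyMeasurable) (hint c ∅)
    (integrable_finsetSum _ fun p _ => hint c {p}).aestronglyMeasurable
    (Eventually.of_forall fun u c' hc' => ?_) hB
    (Eventually.of_forall fun u c' _ => hasDerivAt_regIntegrand γ a c' 0 u)).2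
  · rw [integral_finsetSum _ fun p _ => hint c {p}] at h
    exact h
  · have hc : c' ≤ c + 1 := by
      rw [Metric.mem_ball, Real.dist_eq, abs_lt] at hc'; linarith
    calc ‖∑ p, regIntegrand γ a c' 0 {p} u‖ ≤ ∑ p : Fin N, ‖regIntegrand γ a c' 0 {p} u‖ :=
          norm_sum_le _ _
      _ ≤ ∑ p : Fin N, (2 ^ (γ / 2)) ^ (N * N) * Real.exp (c + 1) ^ N *
          ∏ j, ‖zvar (u j)‖ ^ (2 * γ * N + 1 - a) := by
          refine Finset.sum_le_sum fun p _ =>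
            (norm_regIntegrand_le hγ.le le_rfl zero_le_one {p} u).trans ?_
          gcongr
      _ = B u := by
          simp only [Finset.sum_const, Finset.card_univ, Fintype.card_fin, nsmul_eq_mul, B, C]
          ring

/-- The dependence on the exponential parameter. -/
lemma corrInt_eq_rpow {γ a c : ℝ} {N : ℕ} (hγ : 0 < γ) (ha : 2 * γ * N + 2 < a) (hc : 0 < c) :
    corrInt γ a c (∅ : Finset (Fin N)) =
      ((c ^ (N * (a - 1 - γ * (N - 1))) : ℝ) : ℂ) * corrInt γ a 1 (∅ : Finset (Fin N)) := by
  set κ : ℝ := N * (a - 1 - γ * (N - 1)) with hκ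
  have hd : ∀ x : ℝ, 0 < x → HasDerivAt
      (fun c => ((c ^ (-κ) : ℝ) : ℂ) * corrInt γ a c (∅ : Finset (Fin N))) 0 x := fun x hx => by
    have h1 := (Real.hasDerivAt_rpow_const (p := -κ) (Or.inl hx.ne')).ofReal_comp
    have h2 := h1.mul (hasDerivAt_corrInt x hγ ha)
    refine h2.congr_deriv ?_
    have hp : ∀ p : Fin N, corrInt γ a x {p} =
        ((a - 1 - γ * (N - 1) : ℝ) : ℂ) / x * corrInt γ a x (∅ : Finset (Fin N)) := fun p => by
      have := corrInt_insert x hγ ha (Finset.notMem_empty p)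
      have hx' : (x : ℂ) ≠ 0 := by exact_mod_cast hx.ne'
      rw [div_mul_eq_mul_div, eq_div_iff hx', mul_comm]
      simpa using this
    simp only [hp, Finset.sum_const, Finset.card_univ, Fintype.card_fin, nsmul_eq_mul]
    rw [Real.rpow_sub_one hx.ne', hκ]
    push_cast
    ring
  have hconst := isOpen_Ioi.is_const_of_deriv_eq_zero (s := Set.Ioi (0 : ℝ))
    (convex_Ioi (0 : ℝ)).isPreconnected
    (fun x hx => (hd x hx).differentiableAt.differentiableWithinAt)
    (fun x hx => (hd x hx).deriv) (Set.mem_Ioi.2 hc) (Set.mem_Ioi.2 one_pos)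
  simp only [Real.one_rpow, Complex.ofReal_one, one_mul] at hconst
  rw [← hconst, ← mul_assoc, ← Complex.ofReal_mul, ← Real.rpow_add hc, add_neg_cancel,
    Real.rpow_zero, Complex.ofReal_one, one_mul]

lemma regWeight_zero_smul (γ : ℝ) {s : ℝ} (hs : 0 < s) {N : ℕ} (u : Fin N → ℝ) :
    regWeight γ 0 (s • u) = (s ^ γ) ^ (N * (N - 1)) * regWeight γ 0 u := by
  have h : ∀ i j : Fin N, (((s • u) i - (s • u) j) ^ 2 + 0) ^ (γ / 2) =
      s ^ γ * ((u i - u j) ^ 2 + 0) ^ (γ / 2) := fun i j => by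
    rw [Pi.smul_apply, Pi.smul_apply, smul_eq_mul, smul_eq_mul, ← mul_sub, add_zero, add_zero,
      mul_pow, Real.mul_rpow (by positivity) (by positivity), ← Real.rpow_natCast s,
      ← Real.rpow_mul hs.le]
    congr 2; push_cast; ring
  simp only [regWeight, h, Finset.prod_mul_distrib, Finset.prod_const, Finset.card_compl,
    Finset.card_singleton, Fintype.card_fin, Finset.card_univ]
  rw [← pow_mul, mul_comm (N - 1)]

lemma factor_sqrt_mul {γ t : ℝ} (ht : 0 < t) (x : ℝ) :
    factor (γ / t) (γ / t) (√t * x) = (Real.exp (γ / t) : ℂ) *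
      (Complex.exp (-Complex.I * γ * x / (√t : ℝ)) *
        (1 - Complex.I * (√t : ℝ) * x) ^ (((-γ / t : ℝ)) : ℂ)) := by
  have hs : (√t : ℂ) ≠ 0 := by
    exact_mod_cast (Real.sqrt_pos.2 ht).ne'
  have ht' : (t : ℂ) = (√t : ℂ) ^ 2 := by
    rw [← Complex.ofReal_pow, Real.sq_sqrt ht.le]
  rw [factor, neg_div, ← mul_assoc, Complex.ofReal_exp, ← Complex.exp_add, zvar]
  congr 2
  · push_cast
    rw [ht']
    field_simp
    ring
  · push_cast; ring

lemma numIntegrand_eq {γ t : ℝ} (ht : 0 < t) (N : ℕ) (l : Fin N → ℝ) :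
    numIntegrand γ N t l = ((((√t ^ γ) ^ (N * (N - 1)))⁻¹ * Real.exp (-(N * (γ / t))) : ℝ) : ℂ) *
      regIntegrand γ (γ / t) (γ / t) 0 ∅ (√t • l) := by
  have hs := Real.sqrt_pos.2 ht
  simp only [regIntegrand, numIntegrand, Finset.prod_empty, mul_one, Pi.smul_apply, smul_eq_mul,
    factor_sqrt_mul ht, regWeight_zero_smul γ hs, regWeight_zero]
  rw [Finset.prod_mul_distrib (f := fun _ => (Real.exp (γ / t) : ℂ)), Finset.prod_const,
    Finset.card_univ, Fintype.card_fin, ← Complex.ofReal_pow, ← Real.exp_nat_mul, Real.exp_neg]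
  generalize (∏ x : Fin N, Complex.exp (-Complex.I * γ * (l x) / (√t : ℝ)) *
    (1 - Complex.I * (√t : ℝ) * (l x)) ^ (((-γ / t : ℝ)) : ℂ)) = Q
  push_cast
  have h1 : (((√t ^ γ : ℝ) : ℂ)) ≠ 0 := by
    exact_mod_cast (Real.rpow_pos_of_pos hs γ).ne'
  field_simp

lemma norm_numIntegrand {γ t : ℝ} (ht : 0 < t) (N : ℕ) (l : Fin N → ℝ) :
    ‖numIntegrand γ N t l‖ = |V l| ^ (2 * γ) * ∏ j, (1 + t * l j ^ 2) ^ (-γ / (2 * t)) := by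
  rw [numIntegrand, norm_mul, Complex.norm_real, Real.norm_of_nonneg (by positivity), norm_prod]
  congr 1
  refine Finset.prod_congr rfl fun j _ => ?_
  have h1 : (1 : ℂ) - Complex.I * (√t : ℝ) * (l j) = zvar (√t * l j) := by
    simp only [zvar]; push_cast; ring
  have h2 : -Complex.I * γ * (l j) / (√t : ℝ) = ((-(γ * l j / √t) : ℝ) : ℂ) * Complex.I := by
    push_cast; ring
  rw [norm_mul, h1, h2, Complex.norm_exp_ofReal_mul_I, one_mul, Complex.norm_cpow_real, norm_zvar,
    ← Real.rpow_mul (by positivity), mul_pow, Real.sq_sqrt ht.le]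
  congr 1
  field_simp

lemma integrable_numIntegrand {γ t : ℝ} (hγ : 0 < γ) (ht : 0 < t) {N : ℕ}
    (h : 2 * γ * N + 2 < γ / t) : Integrable (numIntegrand γ N t) := by
  rw [funext (numIntegrand_eq ht N)]
  exact ((integrable_regIntegrand (γ / t) hγ.le h le_rfl zero_le_one ∅).comp_smul
    (Real.sqrt_pos.2 ht).ne').const_mul _

lemma norm_numIntegrand_le {γ t t₀ : ℝ} (hγ : 0 < γ) (ht : 0 < t) (htt : t ≤ t₀) {N : ℕ}
    (l : Fin N → ℝ) : ‖numIntegrand γ N t l‖ ≤ ‖numIntegrand γ N t₀ l‖ := by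
  have ht₀ : 0 < t₀ := ht.trans_le htt
  rw [norm_numIntegrand ht, norm_numIntegrand ht₀]
  have h : ∀ j, (1 + t * l j ^ 2) ^ (-γ / (2 * t)) ≤ (1 + t₀ * l j ^ 2) ^ (-γ / (2 * t₀)) := by
    intro j
    have hx : 0 ≤ t * l j ^ 2 := by positivity
    have h1 := one_add_mul_self_le_rpow_one_add (s := t * l j ^ 2) (by linarith) (p := t₀ / t)
      ((one_le_div ht).2 htt)
    have h2 : 1 + t₀ / t * (t * l j ^ 2) = 1 + t₀ * l j ^ 2 := by field_simp
    rw [h2] at h1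
    have h3 : (1 + t * l j ^ 2) ^ (-γ / (2 * t)) =
        ((1 + t * l j ^ 2) ^ (t₀ / t)) ^ (-γ / (2 * t₀)) := by
      rw [← Real.rpow_mul (by positivity)]
      congr 1
      field_simp
    rw [h3]
    refine Real.rpow_le_rpow_of_nonpos (by positivity) h1 ?_
    rw [neg_div]
    exact neg_nonpos.2 (by positivity)
  gcongr with j
  exact h j

lemma tendsto_exp_mul_cpow (γ x : ℝ) :
    Tendsto (fun t : ℝ => Complex.exp (-Complex.I * γ * x / (√t : ℝ)) *
        (1 - Complex.I * (√t : ℝ) * x) ^ (((-γ / t : ℝ)) : ℂ)) (𝓝[>] 0)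
      (𝓝 (Complex.exp ((-γ * x ^ 2 / 2 : ℝ) : ℂ))) := by
  set R : ℝ → ℂ := fun t => Complex.log (1 + -(Complex.I * (√t : ℝ) * x)) -
    Complex.logTaylor 3 (-(Complex.I * (√t : ℝ) * x))
  have hlog : ∀ z : ℂ, Complex.logTaylor 3 z = z - z ^ 2 / 2 := fun z => by
    simp [Complex.logTaylor, Finset.sum_range_succ]; ring
  have hform : ∀ t : ℝ, 0 < t → Complex.exp (-Complex.I * γ * x / (√t : ℝ)) *
      (1 - Complex.I * (√t : ℝ) * x) ^ (((-γ / t : ℝ)) : ℂ) =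
      Complex.exp (((-γ * x ^ 2 / 2 : ℝ) : ℂ) - γ / t * R t) := fun t ht => by
    have hs : (√t : ℂ) ≠ 0 := by exact_mod_cast (Real.sqrt_pos.2 ht).ne'
    have ht' : (t : ℂ) = (√t : ℂ) ^ 2 := by rw [← Complex.ofReal_pow, Real.sq_sqrt ht.le]
    have hz : (1 : ℂ) - Complex.I * (√t : ℝ) * x ≠ 0 := by
      have := zvar_ne_zero (√t * x)
      simpa [zvar, mul_assoc] using this
    rw [Complex.cpow_def_of_ne_zero hz, ← Complex.exp_add]
    congr 1
    simp only [R, hlog, ← sub_eq_add_neg]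
    push_cast
    rw [ht']
    field_simp
    ring_nf
    simp only [Complex.I_sq]
    ring
  have hsq : Tendsto (fun t : ℝ => √t) (𝓝[>] 0) (𝓝 0) := by
    have := Real.continuous_sqrt.tendsto 0
    rw [Real.sqrt_zero] at this
    exact this.mono_left nhdsWithin_le_nhds
  have hR : Tendsto (fun t : ℝ => (γ / t : ℂ) * R t) (𝓝[>] 0) (𝓝 0) := by
    have hb : Tendsto (fun t : ℝ => |γ| * |x| ^ 3 * √t) (𝓝[>] 0) (𝓝 0) := by
      simpa using hsq.const_mul (|γ| * |x| ^ 3)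
    refine squeeze_zero_norm' ?_ hb
    have hsmall : Tendsto (fun t : ℝ => √t * |x|) (𝓝[>] 0) (𝓝 0) := by
      simpa using hsq.mul_const |x|
    filter_upwards [hsmall.eventually_lt_const (by norm_num : (0 : ℝ) < 1 / 2),
      self_mem_nhdsWithin] with t h1 ht
    have ht : 0 < t := ht
    have hs := Real.sqrt_pos.2 ht
    have hn : ‖-(Complex.I * (√t : ℝ) * x)‖ = √t * |x| := by
      rw [norm_neg, norm_mul, norm_mul, Complex.norm_I, Complex.norm_real, Complex.norm_real,
        Real.norm_of_nonneg hs.le, one_mul, Real.norm_eq_abs]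
    have h2 := Complex.norm_log_sub_logTaylor_le 2 (z := -(Complex.I * (√t : ℝ) * x))
      (by rw [hn]; linarith)
    rw [hn] at h2
    have h3 : (1 - √t * |x|)⁻¹ ≤ 2 := by
      rw [inv_le_comm₀ (by linarith) two_pos]; linarith
    have h4 : ‖R t‖ ≤ (√t * |x|) ^ 3 := by
      refine h2.trans ?_
      calc (√t * |x|) ^ (2 + 1) * (1 - √t * |x|)⁻¹ / ((2 : ℕ) + 1)
          ≤ (√t * |x|) ^ (2 + 1) * 2 / ((2 : ℕ) + 1) := by gcongr
        _ ≤ (√t * |x|) ^ 3 := by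
          have : 0 ≤ (√t * |x|) ^ 3 := by positivity
          push_cast
          norm_num
          linarith
    rw [norm_mul, norm_div, Complex.norm_real, Complex.norm_real, Real.norm_of_nonneg ht.le,
      Real.norm_eq_abs]
    calc |γ| / t * ‖R t‖ ≤ |γ| / t * (√t * |x|) ^ 3 := by gcongr
      _ = |γ| * |x| ^ 3 * √t * (√t ^ 2 / t) := by ring
      _ = |γ| * |x| ^ 3 * √t := by rw [Real.sq_sqrt ht.le, div_self ht.ne', mul_one]
  have hE := (hR.const_sub ((-γ * x ^ 2 / 2 : ℝ) : ℂ)).cexp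
  rw [sub_zero] at hE
  refine hE.congr' ?_
  filter_upwards [self_mem_nhdsWithin] with t ht
  exact (hform t ht).symm

lemma tendsto_numIntegrand (γ : ℝ) {N : ℕ} (l : Fin N → ℝ) :
    Tendsto (fun t => numIntegrand γ N t l) (𝓝[>] 0) (𝓝 ((denIntegrand γ N l : ℝ) : ℂ)) := by
  have h := (tendsto_finsetProd (Finset.univ : Finset (Fin N)) fun j _ =>
    tendsto_exp_mul_cpow γ (l j)).const_mul ((|V l| ^ (2 * γ) : ℝ) : ℂ)
  have e : ((denIntegrand γ N l : ℝ) : ℂ) = ((|V l| ^ (2 * γ) : ℝ) : ℂ) *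
      ∏ j, Complex.exp ((-γ * l j ^ 2 / 2 : ℝ) : ℂ) := by
    rw [← Complex.exp_sum, ← Complex.ofReal_sum, ← Finset.sum_div, ← Finset.mul_sum,
      ← Complex.ofReal_exp, ← Complex.ofReal_mul]
    rfl
  rw [e]
  exact h

lemma continuous_V (N : ℕ) : Continuous (V : (Fin N → ℝ) → ℝ) := by
  unfold V; fun_prop

lemma continuous_denIntegrand {γ : ℝ} (hγ : 0 < γ) (N : ℕ) : Continuous (denIntegrand γ N) := by
  unfold denIntegrand
  refine Continuous.mul ?_ (by fun_prop)
  exact ((continuous_V N).abs).rpow_const fun _ => Or.inr (by positivity)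

lemma eventually_lt_div {γ : ℝ} (hγ : 0 < γ) (A : ℝ) : ∀ᶠ t in 𝓝[>] (0 : ℝ), 0 < t ∧ A < γ / t := by
  have h : Tendsto (fun t : ℝ => γ / t) (𝓝[>] 0) atTop := by
    simp only [div_eq_mul_inv]
    exact tendsto_inv_nhdsGT_zero.const_mul_atTop hγ
  filter_upwards [self_mem_nhdsWithin, h.eventually_gt_atTop A] with t h1 h2
  exact ⟨h1, h2⟩

lemma integrable_denIntegrand {γ : ℝ} (hγ : 0 < γ) (N : ℕ) : Integrable (denIntegrand γ N) := by
  obtain ⟨t₀, ht₀, h₀⟩ := (eventually_lt_div hγ (2 * γ * N + 2)).exists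
  refine (integrable_numIntegrand hγ ht₀ h₀).norm.mono'
    (continuous_denIntegrand hγ N).aestronglyMeasurable (Eventually.of_forall fun l => ?_)
  rw [← Complex.norm_real]
  refine le_of_tendsto (tendsto_numIntegrand γ l).norm ?_
  filter_upwards [Ioc_mem_nhdsGT ht₀] with t ht
  exact norm_numIntegrand_le hγ ht.1 ht.2 l

lemma integral_denIntegrand_pos {γ : ℝ} (hγ : 0 < γ) (N : ℕ) :
    0 < ∫ l : Fin N → ℝ, denIntegrand γ N l := by
  refine integral_pos_of_integrable_nonneg_nonzero (continuous_denIntegrand hγ N)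
    (x := fun i => (i : ℝ)) (integrable_denIntegrand hγ N) (fun l => ?_) ?_
  · simp only [Pi.zero_apply, denIntegrand]; positivity
  · have hV : V (fun i : Fin N => (i : ℝ)) ≠ 0 := by
      refine Finset.prod_ne_zero_iff.2 fun i _ => Finset.prod_ne_zero_iff.2 fun j hj => ?_
      have hij : i < j := Finset.mem_Ioi.1 hj
      exact sub_ne_zero.2 (Nat.cast_injective.ne (Fin.val_injective.ne hij.ne'))
    have := abs_pos.2 hV
    simp only [denIntegrand]
    positivity

lemma tendsto_W {γ : ℝ} (hγ : 0 < γ) (N : ℕ) : Tendsto (W γ N) (𝓝[>] 0) (𝓝 1) := by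
  obtain ⟨t₀, ht₀, h₀⟩ := (eventually_lt_div hγ (2 * γ * N + 2)).exists
  have h : Tendsto (fun t => ∫ l, numIntegrand γ N t l) (𝓝[>] 0)
      (𝓝 (∫ l, ((denIntegrand γ N l : ℝ) : ℂ))) := by
    refine tendsto_integral_filter_of_dominated_convergence (fun l => ‖numIntegrand γ N t₀ l‖)
      ?_ ?_ (integrable_numIntegrand hγ ht₀ h₀).norm
      (Eventually.of_forall fun l => tendsto_numIntegrand γ l)
    · filter_upwards [eventually_lt_div hγ (2 * γ * N + 2)] with t ht
      exact (integrable_numIntegrand hγ ht.1 ht.2).aestronglyMeasurable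
    · filter_upwards [Ioc_mem_nhdsGT ht₀] with t ht
      exact Eventually.of_forall fun l => norm_numIntegrand_le hγ ht.1 ht.2 l
  have h2 := h.div_const ((∫ l : Fin N → ℝ, denIntegrand γ N l : ℝ) : ℂ)
  rw [integral_complex_ofReal, div_self] at h2
  · exact h2
  · exact_mod_cast (integral_denIntegrand_pos hγ N).ne'

/-- `log W_γ(N, γ/(a+1)) - log W_γ(N, γ/a)`. -/
def logIncrement (γ : ℝ) (N : ℕ) (a : ℝ) : ℝ :=
  -∑ i ∈ Finset.range N, (Real.log (1 + -(i * γ) / a) + 1 -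
    (a + 1 / 2 + -(i * γ)) * Real.log (1 + 1 / a))

/-- The logarithm of the elementary prefactor of the numerator of `W_γ(N, γ/a)`. -/
def logPrefactor (γ : ℝ) (N : ℕ) (a : ℝ) : ℝ :=
  (γ * N * (N - 1) + N) / 2 * Real.log (a / γ) - N * a +
    N * (a - 1 - γ * (N - 1)) * Real.log a

lemma integral_numIntegrand {γ a : ℝ} (hγ : 0 < γ) {N : ℕ} (hN : 1 ≤ N)
    (ha : 2 * γ * N + 2 < a) :
    ∫ l, numIntegrand γ N (γ / a) l =
      ((Real.exp (logPrefactor γ N a) : ℝ) : ℂ) * corrInt γ a 1 (∅ : Finset (Fin N)) := by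
  have ha0 : 0 < a := lt_trans (by positivity) ha
  have ht : 0 < γ / a := by positivity
  have hta : γ / (γ / a) = a := by field_simp
  have hs : 0 < √(γ / a) := Real.sqrt_pos.2 ht
  rw [integral_congr_ae (Eventually.of_forall (numIntegrand_eq ht N)), integral_const_mul,
    Measure.integral_comp_smul volume (regIntegrand γ (γ / (γ / a)) (γ / (γ / a)) 0 ∅), hta]
  change _ * (_ • corrInt γ a a (∅ : Finset (Fin N))) = _
  rw [corrInt_eq_rpow hγ ha ha0, Complex.real_smul, ← mul_assoc, ← mul_assoc,
    ← Complex.ofReal_mul, ← Complex.ofReal_mul]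
  congr 2
  rw [Module.finrank_fintype_fun_eq_card, Fintype.card_fin, abs_of_pos (by positivity)]
  have hsl : Real.log √(γ / a) = -(Real.log (a / γ) / 2) := by
    rw [Real.log_sqrt ht.le, ← inv_div a γ, Real.log_inv]; ring
  rw [← Real.exp_log hs, ← Real.exp_mul, ← Real.exp_nat_mul, ← Real.exp_nat_mul, ← Real.exp_neg,
    ← Real.exp_neg, ← Real.exp_add, Real.rpow_def_of_pos ha0, ← Real.exp_add, ← Real.exp_add, hsl,
    logPrefactor]
  congr 1
  push_cast [Nat.cast_sub hN]
  ring

lemma logPrefactor_succ {γ a : ℝ} (hγ : 0 < γ) {N : ℕ} (ha : 2 * γ * N + 2 < a) :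
    Real.exp (logPrefactor γ N (a + 1)) =
      Real.exp (logIncrement γ N a) * Real.exp (logPrefactor γ N a) *
        ∏ i ∈ Finset.range N, (a - γ * i) := by
  have ha0 : 0 < a := lt_trans (by positivity) ha
  have hpos : ∀ i ∈ Finset.range N, 0 < a - γ * i := fun i hi => by
    have : (i : ℝ) ≤ N := by exact_mod_cast (Finset.mem_range.1 hi).le
    nlinarith
  have hprod : ∏ i ∈ Finset.range N, (a - γ * i) =
      Real.exp (∑ i ∈ Finset.range N, Real.log (a - γ * i)) := by
    rw [Real.exp_sum]
    exact Finset.prod_congr rfl fun i hi => (Real.exp_log (hpos i hi)).symm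
  rw [hprod, ← Real.exp_add, ← Real.exp_add]
  congr 1
  have hlog : ∀ i ∈ Finset.range N, Real.log (a - γ * i) =
      Real.log (1 + -(i * γ) / a) + Real.log a := fun i hi => by
    have h1 : 1 + -(i * γ) / a = (a - γ * i) / a := by field_simp; ring
    rw [h1, Real.log_div (hpos i hi).ne' ha0.ne']; ring
  have h1 : Real.log (1 + 1 / a) = Real.log (a + 1) - Real.log a := by
    rw [← Real.log_div (by positivity) ha0.ne']
    congr 1; field_simp
  have hsum : ∑ i ∈ Finset.range N, (i : ℝ) = N * (N - 1) / 2 := by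
    have : ∀ n : ℕ, ∑ i ∈ Finset.range n, (i : ℝ) = n * (n - 1) / 2 := fun n => by
      induction n with
      | zero => simp
      | succ n ih => rw [Finset.sum_range_succ, ih]; push_cast; ring
    exact this N
  rw [Finset.sum_congr rfl hlog, logIncrement, logPrefactor, logPrefactor, h1,
    Real.log_div (by positivity) hγ.ne', Real.log_div ha0.ne' hγ.ne']
  simp only [Finset.sum_add_distrib, Finset.sum_sub_distrib, ← Finset.sum_mul,
    Finset.sum_neg_distrib, Finset.sum_const, Finset.card_range, nsmul_eq_mul, hsum]
  ring

lemma W_succ {γ a : ℝ} (hγ : 0 < γ) {N : ℕ} (hN : 1 ≤ N) (ha : 2 * γ * N + 2 < a) :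
    W γ N (γ / (a + 1)) = ((Real.exp (logIncrement γ N a) : ℝ) : ℂ) * W γ N (γ / a) := by
  have h := corrInt_sub_one (a := a + 1) 1 hγ (N := N) (by linarith)
  rw [add_sub_cancel_right, Complex.ofReal_one, one_pow, one_mul] at h
  rw [W, W, integral_numIntegrand hγ hN ha, integral_numIntegrand (a := a + 1) hγ hN (by linarith),
    h, logPrefactor_succ hγ ha]
  push_cast
  ring

lemma tendsto_div_nhdsGT {γ : ℝ} (hγ : 0 < γ) :
    Tendsto (fun a : ℝ => γ / a) atTop (𝓝[>] 0) := by
  refine tendsto_nhdsWithin_iff.2 ⟨tendsto_const_nhds.div_atTop tendsto_id, ?_⟩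
  filter_upwards [eventually_gt_atTop 0] with a ha
  exact div_pos hγ ha

lemma log_W_succ {γ : ℝ} (hγ : 0 < γ) {N : ℕ} (hN : 1 ≤ N) :
    ∀ᶠ a in atTop, Complex.log (W γ N (γ / (a + 1))) =
      (logIncrement γ N a : ℂ) + Complex.log (W γ N (γ / a)) := by
  have hne := ((tendsto_W hγ N).comp (tendsto_div_nhdsGT hγ)).eventually_ne one_ne_zero
  filter_upwards [eventually_gt_atTop (2 * γ * N + 2), hne] with a ha h0
  have h0 : W γ N (γ / a) ≠ 0 := h0
  rw [W_succ hγ hN ha, Complex.log_ofReal_mul (Real.exp_pos _) h0, Real.log_exp]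

/-- The formal series `log W_γ(x,t)`, given explicitly. -/
def logWSeries (γ : ℝ) : ℝ[X]⟦X⟧ := PowerSeries.mk (logWCoeff γ)

lemma sum_logWSeries {γ : ℝ} (hγ : 0 < γ) (N n : ℕ) (a : ℝ) :
    ∑ k ∈ Finset.range (n + 1), (PowerSeries.coeff k (logWSeries γ)).eval (N : ℝ) * (γ / a) ^ k =
      -∑ i ∈ Finset.range N, ∑ m ∈ Finset.range n,
        stirlingCoeff (m + 1) (-(i * γ)) * (1 / a) ^ (m + 1) := by
  simp only [logWSeries, PowerSeries.coeff_mk, eval_logWCoeff]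
  rw [Finset.sum_range_succ', Finset.sum_comm, ← Finset.sum_neg_distrib]
  simp only [Nat.cast_zero, zero_mul, div_zero, add_zero]
  refine Finset.sum_congr rfl fun m _ => ?_
  rw [Finset.mul_sum, Finset.sum_mul, ← Finset.sum_neg_distrib]
  refine Finset.sum_congr rfl fun i _ => ?_
  rw [stirlingCoeff, div_pow γ, one_div_pow, pow_succ (-1 : ℝ) (m + 1)]
  field_simp

lemma isLogWExpansion_logWSeries {γ : ℝ} (hγ : 0 < γ) : IsLogWExpansion γ (logWSeries γ) := by
  intro N hN n
  set P : ℝ → ℝ := fun a => -∑ i ∈ Finset.range N, ∑ m ∈ Finset.range n,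
        stirlingCoeff (m + 1) (-(i * γ)) * (1 / a) ^ (m + 1) with hP
  have hPlim : Tendsto P atTop (𝓝 0) := by
    have h1 : Tendsto (fun a : ℝ => 1 / a) atTop (𝓝 0) := by
      simpa using tendsto_inv_atTop_zero (𝕜 := ℝ)
    have h2 : Tendsto P atTop (𝓝 (-∑ i ∈ Finset.range N, ∑ m ∈ Finset.range n,
        stirlingCoeff (m + 1) (-(i * γ)) * 0 ^ (m + 1))) :=
      (tendsto_finsetSum _ fun i _ => tendsto_finsetSum _ fun m _ =>
        (h1.pow (m + 1)).const_mul _).neg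
    simpa using h2
  have hlog : Tendsto (fun a => Complex.log (W γ N (γ / a))) atTop (𝓝 0) := by
    have h1 := (tendsto_W hγ N).comp (tendsto_div_nhdsGT hγ)
    have h2 := h1.clog (by simp)
    simpa using h2
  have hv : Tendsto (fun a => Complex.log (W γ N (γ / a)) - (P a : ℂ)) atTop (𝓝 0) := by
    have := hlog.sub ((Complex.continuous_ofReal.tendsto 0).comp hPlim)
    simpa using this
  have hinc : (fun a : ℝ => logIncrement γ N a - (P (a + 1) - P a)) =O[atTop]
      fun a => (1 / a) ^ (n + 2) := by
    have h := IsBigO.sum fun (i : ℕ) (_ : i ∈ Finset.range N) =>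
      stirling_increment_isBigO n (-(i * γ))
    refine h.congr_left fun a => ?_
    simp only [hP, logIncrement, Finset.sum_apply, mul_sub, Finset.sum_sub_distrib]
    ring
  have hd : (fun a : ℝ => (Complex.log (W γ N (γ / (a + 1))) - (P (a + 1) : ℂ)) -
      (Complex.log (W γ N (γ / a)) - (P a : ℂ))) =O[atTop] fun a => (1 / a) ^ (n + 2) := by
    have h1 : (fun a : ℝ => ((logIncrement γ N a - (P (a + 1) - P a) : ℝ) : ℂ)) =O[atTop]
        fun a => (1 / a) ^ (n + 2) := by
      refine IsBigO.of_norm_left ?_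
      simpa only [Complex.norm_real] using hinc.norm_left
    refine h1.congr' ?_ EventuallyEq.rfl
    filter_upwards [log_W_succ hγ hN] with a ha
    rw [ha]
    push_cast
    ring
  have hmain := isLittleO_of_increment hv hd
  have hdiv : Tendsto (fun t : ℝ => γ / t) (𝓝[>] 0) atTop := by
    simp only [div_eq_mul_inv]
    exact tendsto_inv_nhdsGT_zero.const_mul_atTop hγ
  have hcomp := hmain.comp_tendsto hdiv
  have hO : ((fun a : ℝ => (1 / a) ^ n) ∘ fun t => γ / t) =O[𝓝[>] 0] fun t : ℝ => t ^ n := by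
    refine (isBigO_const_mul_self ((1 / γ) ^ n) (fun t : ℝ => t ^ n) _).congr_left fun t => ?_
    change (1 / γ) ^ n * t ^ n = (1 / (γ / t)) ^ n
    rw [one_div_div, ← mul_pow, one_div_mul_eq_div]
  refine (hcomp.trans_isBigO hO).congr' ?_ EventuallyEq.rfl
  filter_upwards [self_mem_nhdsWithin] with t ht
  have ht : 0 < t := ht
  have htt : γ / (γ / t) = t := by field_simp
  simp only [Function.comp_apply, hP, ← sum_logWSeries hγ, htt]

lemma IsLogWExpansion.unique {γ : ℝ} {L L' : ℝ[X]⟦X⟧} (h : IsLogWExpansion γ L)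
    (h' : IsLogWExpansion γ L') : L = L' := by
  have hval : ∀ N : ℕ, 1 ≤ N → ∀ n : ℕ, (PowerSeries.coeff n L).eval (N : ℝ) =
      (PowerSeries.coeff n L').eval (N : ℝ) := by
    intro N hN n
    induction n using Nat.strong_induction_on with
    | _ n ih =>
      have hsub := (h' N hN n).sub (h N hN n)
      set d : ℝ := (PowerSeries.coeff n L).eval (N : ℝ) - (PowerSeries.coeff n L').eval (N : ℝ)
      have hd : (fun t : ℝ => d * t ^ n) =o[𝓝[>] 0] fun t => t ^ n := by
        refine IsLittleO.of_norm_left ?_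
        refine hsub.norm_left.congr_left fun t => ?_
        rw [← Complex.norm_real]
        congr 1
        rw [sub_sub_sub_cancel_left, ← Complex.ofReal_sub, ← Finset.sum_sub_distrib,
          Finset.sum_range_succ, Finset.sum_eq_zero, zero_add, ← sub_mul]
        intro k hk
        rw [ih k (Finset.mem_range.1 hk), sub_self]
      by_contra hne
      have hd0 : d ≠ 0 := sub_ne_zero.2 hne
      have h2 := (isLittleO_const_mul_left_iff hd0).1 hd
      refine isLittleO_irrefl (Eventually.frequently ?_) h2
      filter_upwards [self_mem_nhdsWithin] with t ht
      exact pow_ne_zero n (ne_of_gt ht)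
  ext1 n
  refine Polynomial.eq_of_infinite_eval_eq _ _ ?_
  refine Set.Infinite.mono (s := (fun N : ℕ => (N : ℝ)) '' Set.Ici 1) ?_ ?_
  · rintro _ ⟨N, hN, rfl⟩
    exact hval N hN n
  · exact (Set.Ici_infinite 1).image Nat.cast_injective.injOn

lemma logW_eq {γ : ℝ} (hγ : 0 < γ) : logW γ = logWSeries γ := by
  have h : ∃ L : ℝ[X]⟦X⟧, IsLogWExpansion γ L := ⟨_, isLogWExpansion_logWSeries hγ⟩
  rw [logW, dif_pos h]
  exact h.choose_spec.unique (isLogWExpansion_logWSeries hγ)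

lemma xi_eq {γ : ℝ} (hγ : 0 < γ) {g s : ℕ} (hg : 1 ≤ g) (hs : 1 ≤ s) :
    xi g s γ = ((g + s - 2)! : ℝ) * (-1) ^ (s + 1) / ((g + 1)! : ℝ) *
        ∑ r ∈ Finset.range (g + 2),
          ((g + 1).choose r : ℝ) * (bernoulli (g + 1 - r) : ℝ) *
            ((-1) ^ r * (bernoulli r : ℝ) / γ ^ r) := by
  rw [xi, logW_eq hγ, logWSeries, PowerSeries.coeff_mk, coeff_logWCoeff γ hγ g s hg hs]

end ParamEuler

end

theorem corollary4p3 (γ : ℝ) (hγ : 0 < γ) :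
    -- the integrals that define `W_γ(N,t)` converge for small `t > 0`, and `log W_γ(N,t)` is defined
    (∀ N : ℕ, 1 ≤ N →
      Integrable (ParamEuler.denIntegrand γ N) ∧
      0 < (∫ l : Fin N → ℝ, ParamEuler.denIntegrand γ N l) ∧
      ∀ᶠ t : ℝ in 𝓝[>] (0 : ℝ),
        Integrable (ParamEuler.numIntegrand γ N t) ∧
        ParamEuler.W γ N t ∈ Complex.slitPlane) ∧
    -- the formal series `log W_γ(x,t)` exists and is unique
    (∃! L : ℝ[X]⟦X⟧, ParamEuler.IsLogWExpansion γ L) ∧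
    -- the explicit formula
    ∀ g s : ℕ, 1 ≤ g → 1 ≤ s →
      (Even g →
        ParamEuler.xi g s γ =
          ((g + s - 2)! : ℝ) / (g ! : ℝ) * (-1) ^ s * ((bernoulli g : ℝ) / 2) *
            (1 / γ ^ g - 1 / γ)) ∧
      (Odd g →
        ParamEuler.xi g s γ =
          ((g + s - 2)! : ℝ) * (-1) ^ (s + 1) / ((g + 1)! : ℝ) *
            (((g : ℝ) + 1) * (bernoulli g : ℝ) / γ ^ g +
              ∑ r ∈ Finset.range (g + 2),
                ((g + 1).choose r : ℝ) * (bernoulli (g + 1 - r) : ℝ) *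
                  ((bernoulli r : ℝ) / γ ^ r))) := by
  refine ⟨fun N _ => ⟨ParamEuler.integrable_denIntegrand hγ N,
    ParamEuler.integral_denIntegrand_pos hγ N, ?_⟩,
    ⟨_, ParamEuler.isLogWExpansion_logWSeries hγ,
      fun L hL => hL.unique (ParamEuler.isLogWExpansion_logWSeries hγ)⟩,
    fun g s hg hs => ⟨fun hev => ?_, fun hodd => ?_⟩⟩
  · filter_upwards [ParamEuler.eventually_lt_div hγ (2 * γ * N + 2),
      (ParamEuler.tendsto_W hγ N).eventually_mem
        (Complex.isOpen_slitPlane.mem_nhds Complex.one_mem_slitPlane)] with t ht hW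
    exact ⟨ParamEuler.integrable_numIntegrand hγ ht.1 ht.2, hW⟩
  · rw [ParamEuler.xi_eq hγ hg hs, ParamEuler.sum_bernoulli_of_even γ g hev hg,
      Nat.factorial_succ g]
    push_cast
    field_simp
    ring
  · rw [ParamEuler.xi_eq hγ hg hs, ParamEuler.sum_bernoulli_of_odd γ g hodd]
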